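/- Conventions. Rings and semirings are commutative with unit. A positive totally ordered aura is a semifield $R$ with a total order such that $0<1$ and such that $x\le z$, $y\le t$ imply $x+y\le z+t$ and $xy\le zt$. It has tempered growth if for every non-zero $P\in\mathbb{N}[T]$ and every $x\in R$, the inequalities $x^n\le P(n)$ in $R$ for all $n\in\mathbb{N}$ imply $x\le 1$. A seminorm on a ring $A$ is a map $|.|:A\to R$ to a positive totally ordered aura with $|0|=0$, $|1|=1$, $|ab|\le|a||b|$ and $|a+b|\le|a|+|b|$; it is tempered if $R$ has tempered growth, and multiplicative if $|ab|=|a||b|$. Two seminorms $|.|_1:A\to R_1$ and $|.|_2:A\to R_2$ are multiplicatively equivalent if for all $a,b,c\in A$ one has $|a|_1|c|_1\le|b|_1\Leftrightarrow|a|_2|c|_2\le|b|_2$. A seminorm on $\bar{\mathbb{Q}}[X]$ is upper (resp. lower) bounded if for every $P\neq 0$ there is $\lambda\in\mathbb{Q}^*$ with $|P|\le|\lambda|$ (resp. $|\lambda|\le|P|$). Let $R_{q^{\mathbb{Z}}}=\{0\}\cup q^{\mathbb{Z}}$ be the tropical halo of an infinite cyclic totally ordered group (zero is the least element, and addition is the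 maximum). The lexicographic product of $\mathbb{R}_+$ and $R_{q^{\mathbb{Z}}}$, in which the powers of $q$ dominate, is the positive totally ordered aura $L=\{0\}\cup\{r\,q^n : r\in\mathbb{R}_{>0},\ n\in\mathbb{Z}\}$ with $rq^n\cdot sq^m=(rs)q^{n+m}$, with $rq^n\le sq^m$ if and only if either $q^n<q^m$, or $n=m$ and $r\le s$, and with $rq^n+sq^n=(r+s)q^n$ and $rq^n+sq^m=\max(rq^n,sq^m)$ for $n\neq m$. **Theorem.** Let $|.|:\bar{\mathbb{Q}}[X]\to R$ be a tempered multiplicative seminorm with $|2|>1$. 1. If $|.|$ has non-trivial kernel, then there exist an embedding $\sigma:\bar{\mathbb{Q}}\to\mathbb{C}$ and $a\in\bar{\mathbb{Q}}$ such that $|.|$ is multiplicatively equivalent to $P\mapsto|\sigma(P(a))|_{\mathbb{C}}$. 2. If $|.|$ has trivial kernel and is upper and lower bounded, then there exist an embedding $\sigma:\bar{\mathbb{Q}}\to\mathbb{C}$ and a point $z\in\mathbb{C}\setminus\sigma(\bar{\mathbb{Q}})$ such that $|.|$ is multiplicatively equivalent to the restriction along $\sigma:\bar{\mathbb{Q}}[X]\to\mathbb{C}[X]$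 of the $\mathbb{R}_+$-valued seminorm $Q\mapsto|Q(z)|_{\mathbb{C}}$ on $\mathbb{C}[X]$. 3. If $|.|$ has trivial kernel and is upper but not lower bounded, then there exist an embedding $\sigma:\bar{\mathbb{Q}}\to\mathbb{C}$ and $a\in\bar{\mathbb{Q}}$ such that $|.|$ is multiplicatively equivalent to the $L$-valued seminorm $|.|_{2,a}$ given by $$\Big|\sum_{i=i_0}^n a_i(X-a)^i\Big|_{2,a}=\max_i\big(|\sigma(a_i)|_{\mathbb{C}}\,q^i\big)=|\sigma(a_{i_0})|_{\mathbb{C}}\,q^{i_0}\qquad(a_{i_0}\neq 0),$$ where $q<r$ for all real $r>0$. 4. If $|.|$ has trivial kernel and is lower but not upper bounded, then there exists an embedding $\sigma:\bar{\mathbb{Q}}\to\mathbb{C}$ such that, for every $a\in\bar{\mathbb{Q}}$, $|.|$ is multiplicatively equivalent to the $L$-valued seminorm $|.|_{2,\infty}$ (which does not depend on $a$) given by $$\Big|\sum_{i=0}^n a_i(X-a)^i\Big|_{2,\infty}=\max_i\big(|\sigma(a_i)|_{\mathbb{C}}\,q^i\big)=|\sigma(a_n)|_{\mathbb{C}}\,q^n\qquad(a_n\neq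 0),$$ where $q>r$ for all real $r\ge 0$. Moreover these cases are exhaustive: if $|.|$ has trivial kernel, then it is upper bounded or lower bounded. -/

import Mathlib

open Polynomial
open scoped NNReal

noncomputable section

set_option linter.unusedSectionVars false

/-- A halo: a commutative semiring with a partial order such that
`x ≤ z` and `y ≤ t` imply `x + y ≤ z + t` and `x * y ≤ z * t` (without any sign condition). -/
class IsHalo (R : Type*) [CommSemiring R] [PartialOrder R] : Prop where
  add_le_add' : ∀ {x y z t : R}, x ≤ z → y ≤ t → x + y ≤ z + t
  mul_le_mul' : ∀ {x y z t : R}, x ≤ z → y ≤ t → x * y ≤ z * t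

/-- A positive halo: a halo with `0 < 1`. A *positive totally ordered aura* is
`[Semifield R] [LinearOrder R] [IsPositiveHalo R]`. -/
class IsPositiveHalo (R : Type*) [CommSemiring R] [PartialOrder R] : Prop extends IsHalo R where
  zero_lt_one' : (0 : R) < 1

/-- Tempered growth: for every non-zero `P ∈ ℕ[X]`, if `x ^ n ≤ P(n)` in `R` for all `n`,
then `x ≤ 1`. -/
def TemperedGrowth (R : Type*) [CommSemiring R] [PartialOrder R] : Prop :=
  ∀ P : ℕ[X], P ≠ 0 → ∀ x : R, (∀ n : ℕ, x ^ n ≤ ((P.eval n : ℕ) : R)) → x ≤ 1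

/-- A generalized seminorm on a commutative ring `A`, with values in a positive totally ordered
aura `R`: a halo morphism `A → R`, where `A` has the trivial order. -/
structure GenSeminorm (A R : Type*) [CommRing A] [Semifield R] [LinearOrder R]
    [IsPositiveHalo R] where
  toFun : A → R
  map_zero' : toFun 0 = 0
  map_one' : toFun 1 = 1
  map_mul_le' : ∀ a b, toFun (a * b) ≤ toFun a * toFun b
  map_add_le' : ∀ a b, toFun (a + b) ≤ toFun a + toFun b

namespace GenSeminorm

section Basic

variable {A B R S : Type*} [CommRing A] [CommRing B] [Semifield R] [LinearOrder R]
  [IsPositiveHalo R] [Semifield S] [LinearOrder S] [IsPositiveHalo S]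

instance : CoeFun (GenSeminorm A R) (fun _ => A → R) := ⟨toFun⟩

/-- `|ab| = |a| |b|`. -/
def IsMultiplicative (v : GenSeminorm A R) : Prop := ∀ a b, v (a * b) = v a * v b

/-- The kernel of `v` is not reduced to zero. -/
def HasNontrivialKernel (v : GenSeminorm A R) : Prop := ∃ a : A, a ≠ 0 ∧ v a = 0

/-- `|.|₁ ≤ₘ |.|₂`: for all `a b c`, `|a|₂ |c|₂ ≤ |b|₂` implies `|a|₁ |c|₁ ≤ |b|₁`. -/
def MulBoundedBy (v : GenSeminorm A R) (w : GenSeminorm A S) : Prop :=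
  ∀ a b c : A, w a * w c ≤ w b → v a * v c ≤ v b

/-- Multiplicative equivalence of generalized seminorms. -/
def MulEquivalent (v : GenSeminorm A R) (w : GenSeminorm A S) : Prop :=
  v.MulBoundedBy w ∧ w.MulBoundedBy v

/-- Every non-zero element is bounded above by a non-zero rational number. -/
def UpperBounded [Algebra ℚ A] (v : GenSeminorm A R) : Prop :=
  ∀ a : A, a ≠ 0 → ∃ r : ℚ, r ≠ 0 ∧ v a ≤ v (algebraMap ℚ A r)

/-- Every non-zero element is bounded below by a non-zero rational number. -/
def LowerBounded [Algebra ℚ A] (v : GenSeminorm A R) : Prop :=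
  ∀ a : A, a ≠ 0 → ∃ r : ℚ, r ≠ 0 ∧ v (algebraMap ℚ A r) ≤ v a

/-- The composition of a generalized seminorm with a ring homomorphism. -/
def comap (v : GenSeminorm B R) (f : A →+* B) : GenSeminorm A R where
  toFun a := v (f a)
  map_zero' := by rw [map_zero]; exact v.map_zero'
  map_one' := by rw [map_one]; exact v.map_one'
  map_mul_le' a b := by rw [map_mul]; exact v.map_mul_le' _ _
  map_add_le' a b := by rw [map_add]; exact v.map_add_le' _ _

end Basic

end GenSeminorm

instance : IsPositiveHalo ℝ≥0 where
  add_le_add' h h' := add_le_add h h'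
  mul_le_mul' h h' := mul_le_mul' h h'
  zero_lt_one' := zero_lt_one

/-- The usual complex norm. -/
def complexNorm : GenSeminorm ℂ ℝ≥0 where
  toFun z := ‖z‖₊
  map_zero' := nnnorm_zero
  map_one' := nnnorm_one
  map_mul_le' a b := (nnnorm_mul a b).le
  map_add_le' a b := nnnorm_add_le a b

section HaloLemmas

variable {R : Type*} [Semifield R] [LinearOrder R] [IsPositiveHalo R]

theorem IsPositiveHalo.zero_le' (a : R) : 0 ≤ a := by
  have h := IsHalo.mul_le_mul' (IsPositiveHalo.zero_lt_one' (R := R)).le (le_refl a)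
  rwa [zero_mul, one_mul] at h

theorem IsPositiveHalo.add_eq_zero' {a b : R} (h : a + b = 0) : a = 0 := by
  have h1 : a + 0 ≤ a + b := IsHalo.add_le_add' le_rfl (IsPositiveHalo.zero_le' b)
  rw [h, add_zero] at h1
  exact le_antisymm h1 (IsPositiveHalo.zero_le' a)

theorem IsPositiveHalo.mul_lt_mul_right' {a b c : R} (h : a < b) (hc : c ≠ 0) :
    a * c < b * c :=
  lt_of_le_of_ne (IsHalo.mul_le_mul' h.le le_rfl) fun e => h.ne (mul_right_cancel₀ hc e)

end HaloLemmas

/-- The tropical halo `R_Γ = {0} ∪ Γ` of a totally ordered group `Γ`: the product extends the one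
of `Γ`, zero is the least element, and `a + b = max a b`. -/
def TropHalo (Γ : Type*) : Type _ := WithZero Γ

/-- A totally ordered halo is tropical when `a + b = max a b`. -/
class IsTropical (K : Type*) [Semifield K] [LinearOrder K] : Prop where
  add_eq_max' : ∀ a b : K, a + b = max a b

namespace TropHalo

variable {Γ : Type*} [CommGroup Γ] [LinearOrder Γ] [IsOrderedMonoid Γ]

instance : LinearOrder (TropHalo Γ) := inferInstanceAs (LinearOrder (WithZero Γ))

instance : CommGroupWithZero (TropHalo Γ) := inferInstanceAs (CommGroupWithZero (WithZero Γ))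

theorem zero_le' (a : TropHalo Γ) : 0 ≤ a :=
  zero_le (α := WithZero Γ) (a := a)

theorem withZero_mul_le {a b : WithZero Γ} (h : a ≤ b) (c : WithZero Γ) : a * c ≤ b * c :=
  mul_le_mul' h le_rfl

theorem mul_le_mul_right'' {a b : TropHalo Γ} (h : a ≤ b) (c : TropHalo Γ) : a * c ≤ b * c :=
  withZero_mul_le h c

theorem max_mul' (a b c : TropHalo Γ) : max a b * c = max (a * c) (b * c) := by
  rcases le_total a b with h | h
  · rw [max_eq_right h, max_eq_right (mul_le_mul_right'' h c)]
  · rw [max_eq_left h, max_eq_left (mul_le_mul_right'' h c)]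

instance : Semifield (TropHalo Γ) where
  __ := (inferInstance : CommGroupWithZero (TropHalo Γ))
  add := max
  add_assoc := max_assoc
  zero_add a := max_eq_right (zero_le' a)
  add_zero a := max_eq_left (zero_le' a)
  add_comm := max_comm
  nsmul := @nsmulRec _ ⟨0⟩ ⟨max⟩
  left_distrib a b c := by
    change a * max b c = max (a * b) (a * c)
    rw [mul_comm a, max_mul', mul_comm b, mul_comm c]
  right_distrib a b c := max_mul' a b c
  nnqsmul := _
  nnqsmul_def := fun _ _ => rfl

instance : IsTropical (TropHalo Γ) where
  add_eq_max' _ _ := rfl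

instance : IsPositiveHalo (TropHalo Γ) where
  add_le_add' h h' := max_le_max h h'
  mul_le_mul' {x y z t} h h' := (mul_le_mul_right'' h y).trans (by
    rw [mul_comm z, mul_comm z]; exact mul_le_mul_right'' h' z)
  zero_lt_one' := lt_of_le_of_ne (zero_le' 1) zero_ne_one

/-- The element of `R_Γ` given by an element of `Γ`. -/
def of (g : Γ) : TropHalo Γ := (g : WithZero Γ)

theorem of_ne_zero (g : Γ) : of g ≠ 0 := WithZero.coe_ne_zero

end TropHalo

/-- The underlying set `{0} ∪ K^× × S^× ⊆ K × S` of the lexicographic product of two auras. -/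
@[ext]
structure LexProd (K S : Type*) [Zero K] [Zero S] where
  fst : K
  snd : S
  fst_eq_zero_iff : fst = 0 ↔ snd = 0

namespace LexProd

variable {K S : Type*} [Semifield K] [LinearOrder K] [IsPositiveHalo K]
  [Semifield S] [LinearOrder S] [IsPositiveHalo S]

/-- The lexicographic order, `K` being the dominant factor. -/
instance : LinearOrder (LexProd K S) :=
  LinearOrder.lift' (fun x => toLex (x.fst, x.snd)) fun x y h => by
    have h' : (x.fst, x.snd) = (y.fst, y.snd) := h
    rw [Prod.mk.injEq] at h'
    exact LexProd.ext h'.1 h'.2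

theorem le_iff {x y : LexProd K S} :
    x ≤ y ↔ x.fst < y.fst ∨ x.fst = y.fst ∧ x.snd ≤ y.snd :=
  Prod.Lex.le_iff (x := toLex (x.fst, x.snd)) (y := toLex (y.fst, y.snd))

instance : Zero (LexProd K S) := ⟨⟨0, 0, by simp⟩⟩

instance : One (LexProd K S) := ⟨⟨1, 1, by simp⟩⟩

/-- The product is computed componentwise. -/
instance : Mul (LexProd K S) :=
  ⟨fun x y => ⟨x.fst * y.fst, x.snd * y.snd, by
    rw [mul_eq_zero, mul_eq_zero, x.fst_eq_zero_iff, y.fst_eq_zero_iff]⟩⟩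

instance : Inv (LexProd K S) :=
  ⟨fun x => ⟨x.fst⁻¹, x.snd⁻¹, by rw [inv_eq_zero, inv_eq_zero, x.fst_eq_zero_iff]⟩⟩

/-- Addition, for a tropical dominant factor `K`: as `k + l = max k l` in `K`, the sum retains the
term with the larger `K`-component; if the `K`-components agree, the `S`-components are added.
This is the addition that is compatible with the lexicographic order. -/
instance [IsTropical K] : Add (LexProd K S) :=
  ⟨fun x y =>
    if h₁ : y.fst < x.fst then x else if h₂ : x.fst < y.fst then y else
      ⟨x.fst, x.snd + y.snd, by
        have e : x.fst = y.fst := le_antisymm (not_lt.1 h₁) (not_lt.1 h₂)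
        constructor
        · intro h
          rw [x.fst_eq_zero_iff.1 h, y.fst_eq_zero_iff.1 (e ▸ h), add_zero]
        · intro h
          exact x.fst_eq_zero_iff.2 (IsPositiveHalo.add_eq_zero' h)⟩⟩

variable [IsTropical K]

theorem add_of_gt {x y : LexProd K S} (h : y.fst < x.fst) : x + y = x := dif_pos h

theorem add_of_lt {x y : LexProd K S} (h : x.fst < y.fst) : x + y = y :=
  (dif_neg h.not_gt).trans (dif_pos h)

theorem add_fst (x y : LexProd K S) : (x + y).fst = max x.fst y.fst := by
  rcases lt_trichotomy x.fst y.fst with h | h | h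
  · rw [add_of_lt h, max_eq_right h.le]
  · change (dite _ _ _ : LexProd K S).fst = _
    rw [dif_neg h.not_gt, dif_neg h.not_lt, h, max_self]
  · rw [add_of_gt h, max_eq_left h.le]

theorem add_fst' (x y : LexProd K S) : (x + y).fst = x.fst + y.fst := by
  rw [add_fst, IsTropical.add_eq_max']

theorem add_snd {x y : LexProd K S} (h : x.fst = y.fst) : (x + y).snd = x.snd + y.snd := by
  change (dite _ _ _ : LexProd K S).snd = _
  rw [dif_neg h.not_gt, dif_neg h.not_lt]

@[simp] theorem zero_fst : (0 : LexProd K S).fst = 0 := rfl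
@[simp] theorem zero_snd : (0 : LexProd K S).snd = 0 := rfl
@[simp] theorem one_fst : (1 : LexProd K S).fst = 1 := rfl
@[simp] theorem one_snd : (1 : LexProd K S).snd = 1 := rfl
@[simp] theorem mul_fst (x y : LexProd K S) : (x * y).fst = x.fst * y.fst := rfl
@[simp] theorem mul_snd (x y : LexProd K S) : (x * y).snd = x.snd * y.snd := rfl
@[simp] theorem inv_fst (x : LexProd K S) : (x⁻¹).fst = x.fst⁻¹ := rfl
@[simp] theorem inv_snd (x : LexProd K S) : (x⁻¹).snd = x.snd⁻¹ := rfl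

theorem fst_pos {x : LexProd K S} (h : x ≠ 0) : 0 < x.fst :=
  lt_of_le_of_ne (IsPositiveHalo.zero_le' _) fun e =>
    h (LexProd.ext e.symm (x.fst_eq_zero_iff.1 e.symm))

theorem add_comm'' (x y : LexProd K S) : x + y = y + x := by
  rcases lt_trichotomy x.fst y.fst with h | h | h
  · rw [add_of_lt h, add_of_gt h]
  · apply LexProd.ext
    · rw [add_fst, add_fst, max_comm]
    · rw [add_snd h, add_snd h.symm, add_comm]
  · rw [add_of_lt h, add_of_gt h]

theorem add_assoc'' (x y z : LexProd K S) : x + y + z = x + (y + z) := by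
  rcases lt_trichotomy x.fst y.fst with h | h | h <;>
    rcases lt_trichotomy y.fst z.fst with h' | h' | h'
  · rw [add_of_lt h, add_of_lt h', add_of_lt (h.trans h')]
  · rw [add_of_lt h, add_of_lt (x := x) (y := y + z)]
    rw [add_fst]; exact lt_max_of_lt_left h
  · rw [add_of_lt h, add_of_gt h', add_of_lt h]
  · rw [add_of_lt h', add_of_lt (h.trans_lt h'), add_of_lt]
    rw [add_fst]; exact max_lt (h.trans_lt h') h'
  · apply LexProd.ext
    · simp only [add_fst, max_assoc]
    · rw [add_snd, add_snd h, add_snd, add_snd h', add_assoc]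
      · rw [add_fst, ← h', max_self, h]
      · rw [add_fst, h, max_self, h']
  · rw [add_of_gt h', add_of_gt]
    rw [add_fst]; exact lt_max_of_lt_right h'
  · rw [add_of_lt h', add_of_gt h]
  · rw [add_of_gt h, add_of_gt (h'.symm.trans_lt h), add_of_gt]
    rw [add_fst]; exact max_lt h (h'.symm.trans_lt h)
  · rw [add_of_gt h, add_of_gt h', add_of_gt h, add_of_gt (h'.trans h)]

theorem zero_add'' (x : LexProd K S) : 0 + x = x := by
  by_cases h : x = 0
  · subst h
    apply LexProd.ext
    · rw [add_fst, max_self]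
    · rw [add_snd rfl, zero_snd, add_zero]
  · exact add_of_lt (fst_pos h)

theorem zero_mul'' (x : LexProd K S) : 0 * x = 0 := LexProd.ext (zero_mul _) (zero_mul _)

theorem mul_comm'' (x y : LexProd K S) : x * y = y * x :=
  LexProd.ext (mul_comm _ _) (mul_comm _ _)

theorem add_mul'' (x y z : LexProd K S) : (x + y) * z = x * z + y * z := by
  by_cases hz : z = 0
  · subst hz
    rw [mul_comm'' _ 0, mul_comm'' _ 0, mul_comm'' _ 0, zero_mul'', zero_mul'', zero_mul'',
      zero_add'']
  have hz' : z.fst ≠ 0 := (fst_pos hz).ne'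
  rcases lt_trichotomy x.fst y.fst with h | h | h
  · rw [add_of_lt h, add_of_lt]
    exact IsPositiveHalo.mul_lt_mul_right' h hz'
  · apply LexProd.ext
    · rw [add_fst, mul_fst, add_fst, mul_fst, mul_fst, h, max_self, max_self]
    · rw [add_snd (by rw [mul_fst, mul_fst, h]), mul_snd, add_snd h, add_mul, mul_snd, mul_snd]
  · rw [add_of_gt h, add_of_gt]
    exact IsPositiveHalo.mul_lt_mul_right' h hz'

instance : Semifield (LexProd K S) where
  add_assoc := add_assoc''
  zero_add := zero_add''
  add_zero x := by rw [add_comm'', zero_add'']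
  add_comm := add_comm''
  nsmul := nsmulRec
  left_distrib x y z := by rw [mul_comm'', add_mul'', mul_comm'' y, mul_comm'' z]
  right_distrib := add_mul''
  zero_mul := zero_mul''
  mul_zero x := by rw [mul_comm'', zero_mul'']
  mul_assoc x y z := LexProd.ext (mul_assoc _ _ _) (mul_assoc _ _ _)
  one_mul x := LexProd.ext (one_mul _) (one_mul _)
  mul_one x := LexProd.ext (mul_one _) (mul_one _)
  mul_comm := mul_comm''
  exists_pair_ne := ⟨0, 1, fun h => zero_ne_one (α := K) (congrArg LexProd.fst h)⟩
  inv_zero := LexProd.ext inv_zero inv_zero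
  mul_inv_cancel x hx := LexProd.ext (mul_inv_cancel₀ (fst_pos hx).ne')
    (mul_inv_cancel₀ fun h => (fst_pos hx).ne' (x.fst_eq_zero_iff.2 h))
  nnqsmul := _
  nnqsmul_def := fun _ _ => rfl

theorem mul_le_mul_right'' {x y : LexProd K S} (h : x ≤ y) (z : LexProd K S) : x * z ≤ y * z := by
  by_cases hz : z = 0
  · rw [hz, mul_zero, mul_zero]
  rw [le_iff] at h ⊢
  rcases h with h | ⟨h, h'⟩
  · exact Or.inl (IsPositiveHalo.mul_lt_mul_right' h (fst_pos hz).ne')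
  · exact Or.inr ⟨by rw [mul_fst, mul_fst, h], IsHalo.mul_le_mul' h' le_rfl⟩

theorem add_le_add_right'' {x y : LexProd K S} (h : x ≤ y) (z : LexProd K S) : x + z ≤ y + z := by
  rcases le_iff.1 h with h | ⟨h, h'⟩
  · rcases lt_trichotomy y.fst z.fst with h₁ | h₁ | h₁
    · rw [add_of_lt h₁, add_of_lt (h.trans h₁)]
    · rw [add_of_lt (h.trans_eq h₁), le_iff]
      refine Or.inr ⟨by rw [add_fst, h₁, max_self], ?_⟩
      rw [add_snd h₁]
      have := IsHalo.add_le_add' (IsPositiveHalo.zero_le' y.snd) (le_refl z.snd)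
      rwa [zero_add] at this
    · rw [le_iff, add_of_gt h₁, add_fst]
      exact Or.inl (max_lt h h₁)
  · rcases lt_trichotomy y.fst z.fst with h₁ | h₁ | h₁
    · rw [add_of_lt h₁, add_of_lt (h ▸ h₁)]
    · rw [le_iff]
      refine Or.inr ⟨by rw [add_fst, add_fst, h], ?_⟩
      rw [add_snd h₁, add_snd (h.trans h₁)]
      exact IsHalo.add_le_add' h' le_rfl
    · rw [add_of_gt h₁, add_of_gt (h ▸ h₁), le_iff]
      exact Or.inr ⟨h, h'⟩

instance : IsPositiveHalo (LexProd K S) where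
  add_le_add' {x y z t} h h' := (add_le_add_right'' h y).trans (by
    rw [add_comm z, add_comm z]; exact add_le_add_right'' h' z)
  mul_le_mul' {x y z t} h h' := (mul_le_mul_right'' h y).trans (by
    rw [mul_comm z, mul_comm z]; exact mul_le_mul_right'' h' z)
  zero_lt_one' := lt_of_le_of_ne (le_iff.2 (Or.inl (IsPositiveHalo.zero_lt_one' (R := K))))
    fun h => zero_ne_one (α := K) (congrArg LexProd.fst h)

/-- The embedding `r ↦ (1, r)` (and `0 ↦ 0`) of the second factor. -/
def inr : S →*₀ LexProd K S := by
  classical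
  exact
  { toFun := fun s => if h : s = 0 then 0 else ⟨1, s, by simp [h]⟩
    map_zero' := by simp
    map_one' := by rw [dif_neg one_ne_zero]; rfl
    map_mul' := fun r s => by
      by_cases hr : r = 0
      · simp [hr]
      by_cases hs : s = 0
      · simp [hs]
      rw [dif_neg hr, dif_neg hs, dif_neg (mul_ne_zero hr hs)]
      exact LexProd.ext (one_mul _).symm rfl }

theorem inr_fst {s : S} (h : s ≠ 0) : (inr s : LexProd K S).fst = 1 := by
  change (dite _ _ _ : LexProd K S).fst = _
  rw [dif_neg h]

theorem inr_snd (s : S) : (inr s : LexProd K S).snd = s := by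
  by_cases h : s = 0
  · rw [h, map_zero, zero_snd]
  · change (dite _ _ _ : LexProd K S).snd = _
    rw [dif_neg h]

theorem inr_add (r s : S) : (inr (r + s) : LexProd K S) = inr r + inr s := by
  by_cases hr : r = 0
  · rw [hr, map_zero, zero_add, zero_add]
  by_cases hs : s = 0
  · rw [hs, map_zero, add_zero, add_zero]
  have hrs : r + s ≠ 0 := fun h => hr (IsPositiveHalo.add_eq_zero' h)
  apply LexProd.ext
  · rw [add_fst, inr_fst hr, inr_fst hs, inr_fst hrs, max_self]
  · rw [add_snd (by rw [inr_fst hr, inr_fst hs]), inr_snd, inr_snd, inr_snd]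

theorem inr_mono {r s : S} (h : r ≤ s) : (inr r : LexProd K S) ≤ inr s := by
  by_cases hr : r = 0
  · rw [hr, map_zero]; exact IsPositiveHalo.zero_le' _
  have hs : s ≠ 0 := fun hs => hr (le_antisymm (hs ▸ h) (IsPositiveHalo.zero_le' r))
  exact le_iff.2 (Or.inr ⟨by rw [inr_fst hr, inr_fst hs], by rwa [inr_snd, inr_snd]⟩)

/-- The embedding `k ↦ (k, 1)` of the non-zero elements of the first factor. -/
def inl (k : K) (hk : k ≠ 0) : LexProd K S := ⟨k, 1, by simp [hk]⟩

theorem pow_fst (x : LexProd K S) (n : ℕ) : (x ^ n).fst = x.fst ^ n := by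
  induction n with
  | zero => rw [pow_zero, pow_zero, one_fst]
  | succ n ih => rw [pow_succ, pow_succ, mul_fst, ih]

end LexProd

/-- The lexicographic product of `ℝ₊` and of the tropical halo `R_{q^ℤ} = {0} ∪ q^ℤ` of an infinite
cyclic group, in which the powers of `q` dominate the elements of `ℝ₊`. -/
abbrev InfHalo : Type := LexProd (TropHalo (Multiplicative ℤ)) ℝ≥0

/-- The generator of the infinite cyclic group which is smaller than `1`; as an element of
`InfHalo`, it is smaller than every non-zero element of `ℝ₊` (see `qSmall_lt_inr`). -/
def qSmall : InfHalo := LexProd.inl (TropHalo.of (Multiplicative.ofAdd (-1))) (TropHalo.of_ne_zero _)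

/-- The generator of the infinite cyclic group which is larger than `1`; as an element of
`InfHalo`, it is larger than every element of `ℝ₊` (see `inr_lt_qLarge`). -/
def qLarge : InfHalo := LexProd.inl (TropHalo.of (Multiplicative.ofAdd 1)) (TropHalo.of_ne_zero _)

section Models

variable {F : Type*} [Field F] (σ : F →+* ℂ)

/-- For `P = ∑ i, aᵢ (X - a) ^ i`, the element `|σ aᵢ| q ^ i` of `InfHalo`. -/
def infTerm (a : F) (q : InfHalo) (P : F[X]) (i : ℕ) : InfHalo :=
  LexProd.inr ‖σ ((taylor a P).coeff i)‖₊ * q ^ i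

theorem infTerm_add_le (a : F) (q : InfHalo) (P Q : F[X]) (i : ℕ) :
    infTerm σ a q (P + Q) i ≤ infTerm σ a q P i + infTerm σ a q Q i := by
  rw [infTerm, infTerm, infTerm, ← add_mul, ← LexProd.inr_add, map_add, coeff_add, map_add]
  exact IsHalo.mul_le_mul' (LexProd.inr_mono (nnnorm_add_le _ _)) le_rfl

theorem infTerm_le {a : F} {q : InfHalo} {P : F[X]} {i j : ℕ} (hi : (taylor a P).coeff i ≠ 0)
    (h : (taylor a P).coeff j = 0 ∨ i = j ∨ q.fst ^ j < q.fst ^ i) :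
    infTerm σ a q P j ≤ infTerm σ a q P i := by
  by_cases hj : (taylor a P).coeff j = 0
  · rw [infTerm, hj, map_zero, nnnorm_zero, map_zero, zero_mul]
    exact IsPositiveHalo.zero_le' _
  have hn : ∀ {x : F}, x ≠ 0 → ‖σ x‖₊ ≠ 0 := fun {x} hx =>
    nnnorm_ne_zero_iff.2 ((map_ne_zero σ).2 hx)
  rcases h with h | rfl | h
  · exact absurd h hj
  · exact le_rfl
  · refine LexProd.le_iff.2 (Or.inl ?_)
    rw [infTerm, infTerm, LexProd.mul_fst, LexProd.mul_fst, LexProd.inr_fst (hn hj),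
      LexProd.inr_fst (hn hi), one_mul, one_mul, LexProd.pow_fst, LexProd.pow_fst]
    exact h

theorem qSmall_pow_lt {i j : ℕ} (h : i < j) : qSmall.fst ^ j < qSmall.fst ^ i := by
  change ((Multiplicative.ofAdd (-1 : ℤ) : Multiplicative ℤ) : WithZero (Multiplicative ℤ)) ^ j <
    ((Multiplicative.ofAdd (-1 : ℤ) : Multiplicative ℤ) : WithZero (Multiplicative ℤ)) ^ i
  rw [← WithZero.coe_pow, ← WithZero.coe_pow, WithZero.coe_lt_coe, ← ofAdd_nsmul, ← ofAdd_nsmul,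
    Multiplicative.ofAdd_lt]
  simpa using h

theorem qLarge_pow_lt {i j : ℕ} (h : i < j) : qLarge.fst ^ i < qLarge.fst ^ j := by
  change ((Multiplicative.ofAdd (1 : ℤ) : Multiplicative ℤ) : WithZero (Multiplicative ℤ)) ^ i <
    ((Multiplicative.ofAdd (1 : ℤ) : Multiplicative ℤ) : WithZero (Multiplicative ℤ)) ^ j
  rw [← WithZero.coe_pow, ← WithZero.coe_pow, WithZero.coe_lt_coe, ← ofAdd_nsmul, ← ofAdd_nsmul,
    Multiplicative.ofAdd_lt]
  simpa using h

theorem qSmall_lt_inr {r : ℝ≥0} (h : r ≠ 0) : qSmall < LexProd.inr r := by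
  refine lt_of_not_ge fun h' => ?_
  have h₁ := qSmall_pow_lt zero_lt_one
  rw [pow_one, pow_zero] at h₁
  rcases LexProd.le_iff.1 h' with h₂ | ⟨h₂, -⟩ <;> rw [LexProd.inr_fst h] at h₂
  · exact lt_asymm h₁ h₂
  · exact h₁.ne' h₂

theorem inr_lt_qLarge (r : ℝ≥0) : LexProd.inr r < qLarge := by
  refine lt_of_le_of_lt (LexProd.inr_mono (le_add_of_nonneg_right zero_le_one : r ≤ r + 1)) ?_
  have hr : r + 1 ≠ 0 := by positivity
  refine lt_of_not_ge fun h' => ?_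
  have h₁ := qLarge_pow_lt zero_lt_one
  rw [pow_one, pow_zero] at h₁
  rcases LexProd.le_iff.1 h' with h₂ | ⟨h₂, -⟩ <;> rw [LexProd.inr_fst hr] at h₂
  · exact lt_asymm h₁ h₂
  · exact h₁.ne' h₂

theorem infTerm_le_trailing (a : F) (P : F[X]) (j : ℕ) :
    infTerm σ a qSmall P j ≤ infTerm σ a qSmall P (taylor a P).natTrailingDegree := by
  by_cases hP : taylor a P = 0
  · rw [infTerm, hP, coeff_zero, map_zero, nnnorm_zero, map_zero, zero_mul]
    exact IsPositiveHalo.zero_le' _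
  refine infTerm_le σ (mt trailingCoeff_eq_zero.1 hP) ?_
  rcases lt_trichotomy (taylor a P).natTrailingDegree j with h | h | h
  · exact Or.inr (Or.inr (qSmall_pow_lt h))
  · exact Or.inr (Or.inl h)
  · exact Or.inl (coeff_eq_zero_of_lt_natTrailingDegree h)

theorem infTerm_le_leading (a : F) (P : F[X]) (j : ℕ) :
    infTerm σ a qLarge P j ≤ infTerm σ a qLarge P (taylor a P).natDegree := by
  by_cases hP : taylor a P = 0
  · rw [infTerm, hP, coeff_zero, map_zero, nnnorm_zero, map_zero, zero_mul]
    exact IsPositiveHalo.zero_le' _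
  refine infTerm_le σ (mt leadingCoeff_eq_zero.1 hP) ?_
  rcases lt_trichotomy (taylor a P).natDegree j with h | h | h
  · exact Or.inl (coeff_eq_zero_of_natDegree_lt h)
  · exact Or.inr (Or.inl h)
  · exact Or.inr (Or.inr (qLarge_pow_lt h))

/-- The infinitesimal neighbourhood `|.|_{2,a}` of `a`: for `P = ∑ i, aᵢ (X - a) ^ i ≠ 0` with first
non-zero coefficient `a_{i₀}`, its value is `|σ a_{i₀}| q ^ i₀ = max_i |σ aᵢ| q ^ i`
(see `infTerm_le_trailing`), where `q` is smaller than every positive real number. -/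
def infSeminorm (a : F) : GenSeminorm F[X] InfHalo where
  toFun P := infTerm σ a qSmall P (taylor a P).natTrailingDegree
  map_zero' := by simp [infTerm]
  map_one' := by simp [infTerm, taylor_one]
  map_mul_le' P Q := by
    by_cases hP : P = 0
    · simp [hP, infTerm]
    by_cases hQ : Q = 0
    · simp [hQ, infTerm]
    have hP' := mt (taylor_eq_zero a P).1 hP
    have hQ' := mt (taylor_eq_zero a Q).1 hQ
    have h := trailingCoeff_mul (taylor a P) (taylor a Q)
    simp only [trailingCoeff] at h
    simp only [infTerm]
    rw [taylor_mul, h, natTrailingDegree_mul hP' hQ', map_mul, nnnorm_mul, map_mul, pow_add,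
      mul_mul_mul_comm]
  map_add_le' P Q := (infTerm_add_le σ a qSmall P Q _).trans
    (IsHalo.add_le_add' (infTerm_le_trailing σ a P _) (infTerm_le_trailing σ a Q _))

/-- The infinitesimal point at infinity `|.|_{2,∞}`: for `P = ∑ i ≤ n, aᵢ (X - a) ^ i` with
`a_n ≠ 0`, its value is `|σ a_n| q ^ n = max_i |σ aᵢ| q ^ i` (see `infTerm_le_leading`), where `q`
is larger than every real number. It does not depend on `a`. -/
def inftySeminorm (a : F) : GenSeminorm F[X] InfHalo where
  toFun P := infTerm σ a qLarge P (taylor a P).natDegree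
  map_zero' := by simp [infTerm]
  map_one' := by simp [infTerm, taylor_one]
  map_mul_le' P Q := by
    by_cases hP : P = 0
    · simp [hP, infTerm]
    by_cases hQ : Q = 0
    · simp [hQ, infTerm]
    have hP' := mt (taylor_eq_zero a P).1 hP
    have hQ' := mt (taylor_eq_zero a Q).1 hQ
    have h := leadingCoeff_mul (taylor a P) (taylor a Q)
    simp only [leadingCoeff] at h
    simp only [infTerm]
    rw [taylor_mul, h, natDegree_mul hP' hQ', map_mul, nnnorm_mul, map_mul, pow_add,
      mul_mul_mul_comm]
  map_add_le' P Q := (infTerm_add_le σ a qLarge P Q _).trans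
    (IsHalo.add_le_add' (infTerm_le_leading σ a P _) (infTerm_le_leading σ a Q _))

end Models

end

/-! The classification combines Ostrowski's argument with the Gelfand–Mazur theorem. Tempered growth
is what allows $n$-th roots to be taken in $R$: a bound $|x|^n\le P(n)|y|^n$ for all $n$ gives
$|x|\le|y|$. Expanding integers in a base then shows that, once $|2|>1$, the seminorm orders
$\mathbb{Q}$ as the usual absolute value does (`ratCast_le_iff`).

If every element of a ring $A$ is dominated by a rational, cutting $\mathbb{Q}$ at $|x|$ gives a
real number `archNorm`, which is a multiplicative seminorm extending the usual absolute value. When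
$A$ contains $\sqrt{-1}$, its completion is $\mathbb{C}$ by Gelfand–Mazur, whence a ring
homomorphism $\varphi:A\to\mathbb{C}$ whose norm induces the same order as $|.|$ except among
elements killed by $\varphi$ (`IsMultiplicative.exists_ringHom_complex`). Algebraic numbers are
always dominated by rationals, so the constants of $\bar{\mathbb{Q}}[X]$ are ordered by some
embedding $\sigma$ (`exists_embedding`).

Since polynomials split, a non-trivial kernel contains some $X-a$, and $|P|=|P(a)|$. With trivial
kernel and upper boundedness, $\varphi$ exists on all of $\bar{\mathbb{Q}}[X]$ and is evaluation at
$z=\varphi(X)$. Lower boundedness makes $\varphi$ injective, so $z$ is transcendental over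
$\sigma(\bar{\mathbb{Q}})$; otherwise $\varphi$ kills some $X-a$, which is infinitesimal, and $|P|$
is governed by the order of vanishing at $a$, then by the first coefficient. Without upper
boundedness every $X-a$ dominates all constants, all the $|X-a|$ coincide, and $|P|$ is governed by
the degree, then by the leading coefficient. -/

/-! ### Real-valued multiplicative seminorms and Gelfand–Mazur. -/

theorem exists_ringHom_complex_of_complete {F : Type*} [NormedCommRing F] [NormOneClass F]
    [NormMulClass F] [CompleteSpace F] (f : ℚ →+* F) (hf : ∀ r, ‖f r‖ = |(r : ℝ)|)
    (j : F) (hj : j * j = -1) : ∃ φ : F →+* ℂ, ∀ x, ‖φ x‖ = ‖x‖ := by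
  have hiso : Isometry f := AddMonoidHomClass.isometry_of_norm f fun r => by
    rw [hf, ← Rat.norm_cast_real, Real.norm_eq_abs]
  have hd : IsDenseInducing ((Rat.castHom ℝ : ℚ →+* ℝ) : ℚ → ℝ) :=
    Rat.isDenseEmbedding_coe_real.isDenseInducing
  -- Completeness lets the isometry on `ℚ` extend to `ℝ`; the root `j` of `-1` then extends it to
  -- `ℂ`.
  let g : ℝ →+* F := IsDenseInducing.extendRingHom
    (i := Rat.castHom ℝ) (f := f) Rat.isUniformEmbedding_coe_real.isUniformInducing
    hd.dense hiso.uniformContinuous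
  have hgc : Continuous g :=
    (uniformContinuous_uniformly_extend Rat.isUniformEmbedding_coe_real.isUniformInducing
      hd.dense hiso.uniformContinuous).continuous
  have hgf : ∀ r : ℚ, g r = f r :=
    fun r => hd.extend_eq hiso.continuous r
  have hgn : ∀ x, ‖g x‖ = |x| := by
    intro x
    refine Rat.isDenseEmbedding_coe_real.dense.induction_on (p := fun x => ‖g x‖ = |x|) x
      (isClosed_eq hgc.norm continuous_abs) fun r => ?_
    rw [hgf, hf]
  let : Algebra ℝ F := g.toAlgebra
  let h : ℂ →ₐ[ℝ] F := Complex.liftAux j hj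
  have hle : ∀ z, ‖h z‖ ≤ ‖z‖ := by
    -- A crude constant suffices: as both norms are multiplicative, applying the bound to `z ^ n`
    -- and letting `n` grow replaces `2` by `1`.
    have h2 : ∀ z, ‖h z‖ ≤ 2 * ‖z‖ := by
      intro z
      have : h z = g z.re + g z.im * j := by
        simp [h, Complex.liftAux_apply, Algebra.smul_def]; rfl
      have hj1 : ‖j‖ = 1 := by
        have : ‖j‖ * ‖j‖ = 1 := by rw [← norm_mul, hj, norm_neg, norm_one]
        nlinarith [norm_nonneg j]
      calc ‖h z‖ ≤ |z.re| + |z.im| := by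
            rw [this]
            refine (norm_add_le _ _).trans ?_
            rw [norm_mul, hj1, mul_one, hgn, hgn]
        _ ≤ 2 * ‖z‖ := by
            linarith [Complex.abs_re_le_norm z, Complex.abs_im_le_norm z]
    intro z
    by_contra! hlt
    rcases eq_or_ne z 0 with rfl | hz
    · simp at hlt
    have hz' : 0 < ‖z‖ := norm_pos_iff.2 hz
    obtain ⟨n, hn⟩ := pow_unbounded_of_one_lt 2 ((one_lt_div hz').2 hlt)
    have := h2 (z ^ n)
    rw [map_pow, norm_pow, norm_pow] at this
    rw [div_pow, lt_div_iff₀ (by positivity)] at hn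
    linarith
  let : Algebra ℂ F := h.toRingHom.toAlgebra
  let : NormedAlgebra ℂ F :=
    { norm_smul_le := fun z x => by
        rw [Algebra.smul_def, norm_mul]
        exact mul_le_mul_of_nonneg_right (hle z) (norm_nonneg x) }
  have : Nontrivial F := NormOneClass.nontrivial
  -- Gelfand–Mazur; that `e` preserves norms is then automatic, since `e` is the structure map of a
  -- normed algebra with `‖1‖ = 1`.
  obtain ⟨e⟩ := NormedAlgebra.Complex.nonempty_algEquiv F
  refine ⟨(e.symm : F ≃ₐ[ℂ] ℂ).toRingEquiv.toRingHom, fun x => ?_⟩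
  obtain ⟨z, rfl⟩ := e.surjective x
  have : e z = algebraMap ℂ F z := by
    simpa using e.commutes z
  change ‖e.symm (e z)‖ = _
  rw [e.symm_apply_apply, this, norm_algebraMap']

theorem exists_ringHom_complex_of_seminormed {A : Type*} [SeminormedCommRing A] [NormOneClass A]
    [NormMulClass A] (f : ℚ →+* A) (hf : ∀ r, ‖f r‖ = |(r : ℝ)|)
    (j : A) (hj : j * j = -1) : ∃ φ : A →+* ℂ, ∀ x, ‖φ x‖ = ‖x‖ := by
  have : NormOneClass (UniformSpace.Completion A) :=
    ⟨by rw [← UniformSpace.Completion.coe_one, UniformSpace.Completion.norm_coe, norm_one]⟩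
  have : NormMulClass (UniformSpace.Completion A) := ⟨fun a b => by
    refine UniformSpace.Completion.induction_on₂ a b (isClosed_eq (by fun_prop) (by fun_prop)) ?_
    intro a b
    rw [← UniformSpace.Completion.coe_mul]
    simp only [UniformSpace.Completion.norm_coe, norm_mul]⟩
  obtain ⟨φ, hφ⟩ := exists_ringHom_complex_of_complete
    ((UniformSpace.Completion.coeRingHom (α := A)).comp f)
    (fun r => (UniformSpace.Completion.norm_coe (f r)).trans (hf r))
    (UniformSpace.Completion.coeRingHom j) (by rw [← map_mul, hj, map_neg, map_one])
  exact ⟨φ.comp UniformSpace.Completion.coeRingHom, fun x =>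
    (hφ _).trans (UniformSpace.Completion.norm_coe x)⟩

/-- A multiplicative real-valued seminorm on a ring containing `ℚ` and `√-1`, which extends the
usual absolute value, comes from a ring homomorphism to `ℂ`. -/
theorem exists_ringHom_complex {A : Type*} [CommRing A] (N : A → ℝ) (h0 : N 0 = 0) (h1 : N 1 = 1)
    (hmul : ∀ x y, N (x * y) = N x * N y) (hadd : ∀ x y, N (x + y) ≤ N x + N y)
    (f : ℚ →+* A) (hf : ∀ r, N (f r) = |(r : ℝ)|)
    (j : A) (hj : j * j = -1) : ∃ φ : A →+* ℂ, ∀ x, ‖φ x‖ = N x := by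
  have hneg : ∀ x, N (-x) = N x := fun x => by
    have : N (-1) = 1 := by simpa using hf (-1)
    rw [← neg_one_mul, hmul, this, one_mul]
  let S : AddGroupSeminorm A :=
    { toFun := N
      map_zero' := h0
      add_le' := hadd
      neg' := hneg }
  let : SeminormedCommRing A :=
    { __ := S.toSeminormedAddCommGroup
      __ := ‹CommRing A›
      norm_mul_le := fun x y => (hmul x y).le }
  have : NormOneClass A := ⟨h1⟩
  have : NormMulClass A := ⟨hmul⟩
  exact exists_ringHom_complex_of_seminormed f hf j hj

/-! ### Positive auras as ordered semifields, and root extraction by tempered growth. -/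

section Aura

variable {R : Type*} [Semifield R] [LinearOrder R] [IsPositiveHalo R]

instance IsPositiveHalo.isOrderedRing : IsOrderedRing R where
  add_le_add_left _ _ h _ := IsHalo.add_le_add' h le_rfl
  zero_le_one := IsPositiveHalo.zero_lt_one'.le
  mul_le_mul_of_nonneg_left _ _ _ _ h := IsHalo.mul_le_mul' le_rfl h
  mul_le_mul_of_nonneg_right _ _ _ _ h := IsHalo.mul_le_mul' h le_rfl

instance IsPositiveHalo.mulPosStrictMono : MulPosStrictMono R where
  mul_lt_mul_of_pos_right _ ha _ _ h := IsPositiveHalo.mul_lt_mul_right' h ha.ne'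

instance IsPositiveHalo.posMulStrictMono : PosMulStrictMono R :=
  posMulStrictMono_iff_mulPosStrictMono.2 inferInstance

theorem IsPositiveHalo.pos_of_ne_zero {a : R} (h : a ≠ 0) : 0 < a :=
  lt_of_le_of_ne (IsPositiveHalo.zero_le' a) h.symm

theorem TemperedGrowth.le_of_pow_le (hR : TemperedGrowth R) {P : ℕ[X]} (hP : P ≠ 0) {x y : R}
    (h : ∀ n : ℕ, x ^ n ≤ ((P.eval n : ℕ) : R) * y ^ n) : x ≤ y := by
  rcases eq_or_ne y 0 with rfl | hy
  · simpa using h 1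
  have hy' := IsPositiveHalo.pos_of_ne_zero hy
  rw [← div_le_one₀ hy']
  refine hR P hP _ fun n => ?_
  rw [div_pow, div_le_iff₀ (pow_pos hy' n)]
  exact h n

theorem TemperedGrowth.le_of_pow_le_const (hR : TemperedGrowth R) {c : ℕ} (hc : c ≠ 0) {x y : R}
    (h : ∀ n : ℕ, x ^ n ≤ (c : R) * y ^ n) : x ≤ y :=
  hR.le_of_pow_le (P := (c : ℕ[X])) (by exact_mod_cast hc) (by simpa using h)

theorem TemperedGrowth.le_of_pow_le_linear (hR : TemperedGrowth R) {c : ℕ} (hc : c ≠ 0) {x y : R}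
    (h : ∀ n : ℕ, x ^ n ≤ ((n : R) + 1) * c * y ^ n) : x ≤ y :=
  hR.le_of_pow_le (P := (X + 1) * (c : ℕ[X]))
    (mul_ne_zero (by exact_mod_cast X_add_C_ne_zero (R := ℕ) 1) (by exact_mod_cast hc))
    (by simpa using h)

end Aura

/-! ### Ostrowski's argument: the order induced on the rationals. -/

namespace GenSeminorm

variable {A R : Type*} [CommRing A] [Semifield R] [LinearOrder R] [IsPositiveHalo R]
  {v : GenSeminorm A R}

theorem nonneg (v : GenSeminorm A R) (a : A) : 0 ≤ v a := IsPositiveHalo.zero_le' _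

theorem sum_le (v : GenSeminorm A R) {ι : Type*} (s : Finset ι) (f : ι → A) :
    v (∑ i ∈ s, f i) ≤ ∑ i ∈ s, v (f i) := by
  classical
  induction s using Finset.induction_on with
  | empty => simp [v.map_zero']
  | insert i s hi ih =>
    rw [Finset.sum_insert hi, Finset.sum_insert hi]
    exact (v.map_add_le' _ _).trans (by gcongr)

theorem natCast_le (v : GenSeminorm A R) (n : ℕ) : v (n : A) ≤ n := by
  induction n with
  | zero => simp [v.map_zero']
  | succ n ih =>
    push_cast
    exact (v.map_add_le' _ _).trans (by rw [v.map_one']; gcongr)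

theorem map_ne_zero (hk : ¬ v.HasNontrivialKernel) {a : A} (ha : a ≠ 0) : v a ≠ 0 :=
  fun h => hk ⟨a, ha, h⟩

namespace IsMultiplicative

theorem map_pow (hv : v.IsMultiplicative) (a : A) (n : ℕ) : v (a ^ n) = v a ^ n := by
  induction n with
  | zero => rw [pow_zero, pow_zero, v.map_one']
  | succ n ih => rw [pow_succ, pow_succ, hv, ih]

theorem map_neg_one (hv : v.IsMultiplicative) : v (-1) = 1 := by
  have h : v (-1) ^ 2 = 1 := by rw [← hv.map_pow]; simp [v.map_one']
  exact (pow_eq_one_iff_of_nonneg (v.nonneg _) two_ne_zero).1 h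

theorem map_neg (hv : v.IsMultiplicative) (a : A) : v (-a) = v a := by
  rw [← neg_one_mul, hv, hv.map_neg_one, one_mul]

theorem map_ne_zero_of_unit (hv : v.IsMultiplicative) {a b : A} (h : a * b = 1) : v a ≠ 0 := by
  intro h'
  have := hv a b
  rw [h, h', zero_mul, v.map_one'] at this
  exact one_ne_zero this

/-- Expansion in base `b`: there are `k + 1` digits, and each contributes at most `b * M ^ k`. The
induction strips the last digit. -/
theorem natCast_le_of_lt_pow (hv : v.IsMultiplicative) {b : ℕ} {M : R} (hM : 1 ≤ M)
    (hb0 : b ≠ 0) (hb : v (b : A) ≤ M) (k : ℕ) :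
    ∀ m < b ^ (k + 1), v (m : A) ≤ ((k : R) + 1) * b * M ^ k := by
  induction k with
  | zero =>
    intro m hm
    simp only [zero_add, pow_one] at hm
    have : (m : R) ≤ b := by exact_mod_cast Nat.mono_cast hm.le
    simpa using (v.natCast_le m).trans this
  | succ k ih =>
    intro m hm
    have hq := ih (m / b) (Nat.div_lt_of_lt_mul (by rwa [← pow_succ']))
    have hr : ((m % b : ℕ) : R) ≤ b :=
      Nat.mono_cast (Nat.mod_lt m (Nat.pos_of_ne_zero hb0)).le
    have hM' : (1 : R) ≤ M ^ (k + 1) := one_le_pow₀ hM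
    have hM0 : (0 : R) ≤ M := zero_le_one.trans hM
    calc v (m : A) = v ((b : A) * ((m / b : ℕ) : A) + ((m % b : ℕ) : A)) := by
          rw [← Nat.cast_mul, ← Nat.cast_add, Nat.div_add_mod]
      _ ≤ v (b : A) * v ((m / b : ℕ) : A) + v ((m % b : ℕ) : A) := by
          rw [← hv]; exact v.map_add_le' _ _
      _ ≤ M * (((k : R) + 1) * b * M ^ k) + b * M ^ (k + 1) := by
          refine add_le_add (mul_le_mul hb hq (v.nonneg _) hM0) ?_
          exact (v.natCast_le _).trans (hr.trans (le_mul_of_one_le_right (Nat.cast_nonneg b) hM'))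
      _ = (((k + 1 : ℕ) : R) + 1) * b * M ^ (k + 1) := by push_cast; ring

theorem one_lt_natCast (hv : v.IsMultiplicative) (hR : TemperedGrowth R) (h2 : 1 < v 2) {b : ℕ}
    (hb : 2 ≤ b) : 1 < v (b : A) := by
  by_contra! h
  -- If `v b ≤ 1`, then `2 ^ n < b ^ (n + 1)` has at most `n + 1` digits, so `v 2 ^ n` grows at most
  -- linearly.
  refine h2.not_ge (hR.le_of_pow_le_linear (c := b) (by lia) fun n => ?_)
  rw [← hv.map_pow]
  have := hv.natCast_le_of_lt_pow le_rfl (by lia) h n (2 ^ n)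
    ((Nat.pow_le_pow_left hb n).trans_lt (Nat.pow_lt_pow_right hb n.lt_succ_self))
  simpa using this

theorem natCast_mono (hv : v.IsMultiplicative) (hR : TemperedGrowth R) (h2 : 1 < v 2) {a b : ℕ}
    (hab : a ≤ b) : v (a : A) ≤ v (b : A) := by
  rcases hab.eq_or_lt with rfl | hab
  · rfl
  rcases Nat.lt_or_ge b 2 with hb | hb
  · have ha : a = 0 := by lia
    simp [ha, v.map_zero', v.nonneg]
  -- Base `b` expansion of `a ^ n < b ^ (n + 1)`, now with `M = v b`.
  refine hR.le_of_pow_le_linear (c := b) (by lia) fun n => ?_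
  rw [← hv.map_pow]
  have := hv.natCast_le_of_lt_pow (hv.one_lt_natCast hR h2 hb).le (by lia) le_rfl n (a ^ n)
    ((Nat.pow_le_pow_left hab.le n).trans_lt (Nat.pow_lt_pow_right hb n.lt_succ_self))
  simpa using this

section Rat

variable [Algebra ℚ A]

theorem map_ratCast_ne_zero (hv : v.IsMultiplicative) {r : ℚ} (hr : r ≠ 0) :
    v (algebraMap ℚ A r) ≠ 0 :=
  hv.map_ne_zero_of_unit (b := algebraMap ℚ A r⁻¹) (by rw [← map_mul, mul_inv_cancel₀ hr, map_one])

theorem map_ratCast_pos (hv : v.IsMultiplicative) {r : ℚ} (hr : r ≠ 0) :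
    0 < v (algebraMap ℚ A r) :=
  IsPositiveHalo.pos_of_ne_zero (hv.map_ratCast_ne_zero hr)

theorem map_abs_ratCast (hv : v.IsMultiplicative) (r : ℚ) :
    v (algebraMap ℚ A |r|) = v (algebraMap ℚ A r) := by
  rcases abs_choice r with h | h <;> rw [h]
  rw [_root_.map_neg, hv.map_neg]

theorem ratCast_mono (hv : v.IsMultiplicative) (hR : TemperedGrowth R) (h2 : 1 < v 2) {r s : ℚ}
    (hr : 0 ≤ r) (hrs : r ≤ s) : v (algebraMap ℚ A r) ≤ v (algebraMap ℚ A s) := by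
  have hs := hr.trans hrs
  have hd : ((r.den * s.den : ℕ) : ℚ) ≠ 0 := by
    exact_mod_cast mul_ne_zero r.den_nz s.den_nz
  have hr' : r * (r.den * s.den : ℕ) = (r.num.toNat * s.den : ℕ) := by
    have h1 : ((r.num.toNat : ℤ) : ℚ) = r.num := by
      rw [Int.toNat_of_nonneg (Rat.num_nonneg.2 hr)]
    have h3 := Rat.mul_den_eq_num r
    push_cast at h1 ⊢
    rw [h1, ← mul_assoc, h3]
  have hs' : s * (r.den * s.den : ℕ) = (r.den * s.num.toNat : ℕ) := by
    have h1 : ((s.num.toNat : ℤ) : ℚ) = s.num := by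
      rw [Int.toNat_of_nonneg (Rat.num_nonneg.2 hs)]
    have h3 := Rat.mul_den_eq_num s
    push_cast at h1 ⊢
    rw [h1, mul_left_comm, h3]
  have hnat : r.num.toNat * s.den ≤ r.den * s.num.toNat := by
    have : r * (r.den * s.den : ℕ) ≤ s * (r.den * s.den : ℕ) := by gcongr
    rw [hr', hs'] at this
    exact_mod_cast this
  have := hv.natCast_mono hR h2 hnat
  rw [← map_natCast (algebraMap ℚ A), ← map_natCast (algebraMap ℚ A) (r.den * _), ← hr', ← hs',
    map_mul, map_mul, hv, hv] at this
  exact le_of_mul_le_mul_right this (hv.map_ratCast_pos hd)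

theorem ratCast_strictMono (hv : v.IsMultiplicative) (hR : TemperedGrowth R) (h2 : 1 < v 2)
    {r s : ℚ} (hr : 0 ≤ r) (hrs : r < s) : v (algebraMap ℚ A r) < v (algebraMap ℚ A s) := by
  have hs := hr.trans_lt hrs
  by_contra! h
  -- Powers amplify the gap until `2 * r ^ n ≤ s ^ n`; with `v s ≤ v r` this would force `v 2 ≤ 1`.
  obtain ⟨n, hn⟩ := exists_pow_lt_of_lt_one (y := r / s) (show (0 : ℚ) < 1 / 2 by norm_num)
    ((div_lt_one hs).2 hrs)
  have h3 : 2 * r ^ n ≤ s ^ n := by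
    rw [div_pow, div_lt_iff₀ (by positivity)] at hn
    linarith
  have h4 := hv.ratCast_mono hR h2 (by positivity) h3
  rw [map_mul, hv, _root_.map_pow, _root_.map_pow, hv.map_pow, hv.map_pow, map_ofNat] at h4
  have h5 : 0 < v (algebraMap ℚ A s) ^ n := pow_pos (hv.map_ratCast_pos hs.ne') n
  have h6 : v 2 * v (algebraMap ℚ A s) ^ n ≤ 1 * v (algebraMap ℚ A s) ^ n := by
    rw [one_mul]
    exact (mul_le_mul_of_nonneg_left (pow_le_pow_left₀ (v.nonneg _) h n) (v.nonneg _)).trans h4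
  exact h2.not_ge (le_of_mul_le_mul_right h6 h5)

theorem ratCast_le_iff (hv : v.IsMultiplicative) (hR : TemperedGrowth R) (h2 : 1 < v 2) {r s : ℚ} :
    v (algebraMap ℚ A r) ≤ v (algebraMap ℚ A s) ↔ |r| ≤ |s| := by
  rw [← hv.map_abs_ratCast r, ← hv.map_abs_ratCast s]
  refine ⟨fun h => ?_, fun h => hv.ratCast_mono hR h2 (abs_nonneg r) h⟩
  by_contra! h'
  exact (hv.ratCast_strictMono hR h2 (abs_nonneg s) h').not_ge h

end Rat

end IsMultiplicative

end GenSeminorm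

/-! ### The real seminorm attached to a seminorm dominated by the rationals. -/

namespace GenSeminorm

section ArchNorm

variable {A R : Type*} [CommRing A] [Algebra ℚ A] [Semifield R] [LinearOrder R] [IsPositiveHalo R]
  {v : GenSeminorm A R}

/-- The infimum of the `|r|`, for `r` a rational number such that `|x| ≤ |r|`. -/
noncomputable def archNorm (v : GenSeminorm A R) (x : A) : ℝ :=
  sInf {t | ∃ r : ℚ, v x ≤ v (algebraMap ℚ A r) ∧ |(r : ℝ)| = t}

theorem archNorm_le {x : A} {r : ℚ} (h : v x ≤ v (algebraMap ℚ A r)) : v.archNorm x ≤ |(r : ℝ)| :=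
  csInf_le ⟨0, by rintro _ ⟨r, -, rfl⟩; exact abs_nonneg _⟩ ⟨r, h, rfl⟩

theorem archNorm_nonneg (v : GenSeminorm A R) (x : A) : 0 ≤ v.archNorm x :=
  Real.sInf_nonneg (by rintro _ ⟨r, -, rfl⟩; exact abs_nonneg _)

theorem archNorm_mono (hb : ∀ x, ∃ r : ℚ, v x ≤ v (algebraMap ℚ A r)) {x y : A} (h : v x ≤ v y) :
    v.archNorm x ≤ v.archNorm y := by
  obtain ⟨s, hs⟩ := hb y
  refine le_csInf ⟨_, s, hs, rfl⟩ ?_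
  rintro _ ⟨r, hr, rfl⟩
  exact archNorm_le (h.trans hr)

theorem IsMultiplicative.archNorm_ratCast (hv : v.IsMultiplicative) (hR : TemperedGrowth R)
    (h2 : 1 < v 2) (r : ℚ) : v.archNorm (algebraMap ℚ A r) = |(r : ℝ)| := by
  refine le_antisymm (archNorm_le le_rfl) (le_csInf ⟨_, r, le_rfl, rfl⟩ ?_)
  rintro _ ⟨s, hs, rfl⟩
  exact_mod_cast (hv.ratCast_le_iff hR h2).1 hs

theorem IsMultiplicative.exists_rat_of_archNorm_lt (hv : v.IsMultiplicative)
    (hR : TemperedGrowth R) (h2 : 1 < v 2) (hb : ∀ x, ∃ r : ℚ, v x ≤ v (algebraMap ℚ A r)) {x : A}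
    {t : ℝ} (h : v.archNorm x < t) :
    ∃ r : ℚ, 0 ≤ r ∧ (r : ℝ) < t ∧ v x ≤ v (algebraMap ℚ A r) := by
  obtain ⟨r, hr, hrt⟩ := exists_rat_btwn h
  have hr0 : 0 ≤ r := by exact_mod_cast (v.archNorm_nonneg x).trans hr.le
  refine ⟨r, hr0, hrt, le_of_not_ge fun h' => hr.not_ge ?_⟩
  have := archNorm_mono hb h'
  rwa [hv.archNorm_ratCast hR h2, abs_of_nonneg (by exact_mod_cast hr0)] at this

theorem IsMultiplicative.exists_rat_of_lt_archNorm {x : A} {t : ℝ} (ht : 0 ≤ t)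
    (h : t < v.archNorm x) : ∃ r : ℚ, t < (r : ℝ) ∧ v (algebraMap ℚ A r) ≤ v x := by
  obtain ⟨r, hr, hrt⟩ := exists_rat_btwn h
  refine ⟨r, hr, le_of_not_ge fun h' => hrt.not_ge ?_⟩
  exact (archNorm_le h').trans_eq (abs_of_nonneg (ht.trans hr.le))

theorem IsMultiplicative.archNorm_mul (hv : v.IsMultiplicative) (hR : TemperedGrowth R)
    (h2 : 1 < v 2) (hb : ∀ x, ∃ r : ℚ, v x ≤ v (algebraMap ℚ A r)) (x y : A) :
    v.archNorm (x * y) = v.archNorm x * v.archNorm y := by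
  apply le_antisymm
  · refine le_mul_of_forall_lt₀ fun a ha b hb' => ?_
    obtain ⟨r, hr0, hr, hxr⟩ := hv.exists_rat_of_archNorm_lt hR h2 hb ha
    obtain ⟨s, hs0, hs, hys⟩ := hv.exists_rat_of_archNorm_lt hR h2 hb hb'
    have h : v (x * y) ≤ v (algebraMap ℚ A (r * s)) := by
      rw [hv, map_mul, hv]
      exact mul_le_mul hxr hys (v.nonneg _) (v.nonneg _)
    have hr0' : (0 : ℝ) ≤ r := by exact_mod_cast hr0
    have hs0' : (0 : ℝ) ≤ s := by exact_mod_cast hs0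
    refine (archNorm_le h).trans ?_
    rw [Rat.cast_mul, abs_of_nonneg (by positivity)]
    exact mul_le_mul hr.le hs.le hs0' (hr0'.trans hr.le)
  · refine mul_le_of_forall_lt_of_nonneg (v.archNorm_nonneg _) (v.archNorm_nonneg _)
      fun a ha0 ha b hb0 hb' => ?_
    obtain ⟨r, hr, hxr⟩ := exists_rat_of_lt_archNorm ha0 ha
    obtain ⟨s, hs, hys⟩ := exists_rat_of_lt_archNorm hb0 hb'
    have h : v (algebraMap ℚ A (r * s)) ≤ v (x * y) := by
      rw [hv, map_mul, hv]
      exact mul_le_mul hxr hys (v.nonneg _) (v.nonneg _)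
    refine le_trans ?_ (archNorm_mono hb h)
    rw [hv.archNorm_ratCast hR h2, Rat.cast_mul]
    exact (mul_le_mul hr.le hs.le hb0 (ha0.trans hr.le)).trans (le_abs_self _)

/-- The sum `v r + v s` in `R` need not be at most `v (r + s)`, so the triangle inequality is not
enough. Instead each of the `n + 1` binomial terms of `(x + y) ^ n` is dominated by the matching
term for `r` and `s`, hence by `(r + s) ^ n`, and tempered growth removes the factor `n + 1`. -/
theorem IsMultiplicative.map_add_le_ratCast (hv : v.IsMultiplicative) (hR : TemperedGrowth R)
    (h2 : 1 < v 2) {x y : A} {r s : ℚ} (hr : 0 ≤ r) (hs : 0 ≤ s)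
    (hx : v x ≤ v (algebraMap ℚ A r)) (hy : v y ≤ v (algebraMap ℚ A s)) :
    v (x + y) ≤ v (algebraMap ℚ A (r + s)) := by
  refine hR.le_of_pow_le_linear one_ne_zero fun n => ?_
  rw [← hv.map_pow, ← hv.map_pow, ← _root_.map_pow, add_pow]
  refine (v.sum_le _ _).trans ?_
  have : ∀ k ∈ Finset.range (n + 1), v (x ^ k * y ^ (n - k) * (n.choose k : A)) ≤
      v (algebraMap ℚ A ((r + s) ^ n)) := by
    intro k hk
    have h1 : v (x ^ k * y ^ (n - k) * (n.choose k : A)) ≤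
        v (algebraMap ℚ A (r ^ k * s ^ (n - k) * n.choose k)) := by
      rw [map_mul, map_mul, hv, hv, hv, hv, hv.map_pow, hv.map_pow, _root_.map_pow, _root_.map_pow,
        hv.map_pow, hv.map_pow, map_natCast]
      gcongr <;> exact IsPositiveHalo.zero_le' _
    refine h1.trans (hv.ratCast_mono hR h2 (by positivity) ?_)
    rw [add_pow]
    exact Finset.single_le_sum (f := fun k => r ^ k * s ^ (n - k) * (n.choose k : ℚ))
      (fun i _ => by positivity) hk
  refine (Finset.sum_le_card_nsmul _ _ _ this).trans_eq ?_
  simp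

theorem IsMultiplicative.archNorm_add_le (hv : v.IsMultiplicative) (hR : TemperedGrowth R)
    (h2 : 1 < v 2) (hb : ∀ x, ∃ r : ℚ, v x ≤ v (algebraMap ℚ A r)) (x y : A) :
    v.archNorm (x + y) ≤ v.archNorm x + v.archNorm y := by
  refine le_of_forall_pos_le_add fun e he => ?_
  obtain ⟨r, hr0, hr, hxr⟩ := hv.exists_rat_of_archNorm_lt hR h2 hb
    (lt_add_of_pos_right (v.archNorm x) (half_pos he))
  obtain ⟨s, hs0, hs, hys⟩ := hv.exists_rat_of_archNorm_lt hR h2 hb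
    (lt_add_of_pos_right (v.archNorm y) (half_pos he))
  have h := archNorm_le (hv.map_add_le_ratCast hR h2 hr0 hs0 hxr hys)
  rw [abs_of_nonneg (by exact_mod_cast add_nonneg hr0 hs0), Rat.cast_add] at h
  linarith

theorem IsMultiplicative.le_of_archNorm_le (hv : v.IsMultiplicative) (hR : TemperedGrowth R)
    (h2 : 1 < v 2) (hb : ∀ x, ∃ r : ℚ, v x ≤ v (algebraMap ℚ A r)) {x y : A}
    (hy : v.archNorm y ≠ 0) (h : v.archNorm x ≤ v.archNorm y) : v x ≤ v y := by
  have hN1 : v.archNorm 1 = 1 := by simpa using hv.archNorm_ratCast hR h2 1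
  have hpow : ∀ (z : A) (n : ℕ), v.archNorm (z ^ n) = v.archNorm z ^ n := by
    intro z n
    induction n with
    | zero => simpa using hN1
    | succ n ih => rw [pow_succ, pow_succ, hv.archNorm_mul hR h2 hb, ih]
  have hN2 : v.archNorm 2 = 2 := by
    have := hv.archNorm_ratCast hR h2 2
    rw [map_ofNat] at this
    simpa using this
  -- The factor `2` makes the inequality of real norms strict, so that it lifts to `R`; tempered
  -- growth then absorbs it.
  refine hR.le_of_pow_le_const (c := 2) two_ne_zero fun n => ?_
  have hyn : 0 < v.archNorm y ^ n := pow_pos ((v.archNorm_nonneg y).lt_of_ne' hy) n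
  have hlt : v.archNorm (x ^ n) < v.archNorm (2 * y ^ n) := by
    rw [hv.archNorm_mul hR h2 hb, hN2, hpow, hpow]
    have := pow_le_pow_left₀ (v.archNorm_nonneg x) h n
    linarith
  have h3 : v (x ^ n) ≤ v (2 * y ^ n) :=
    le_of_not_ge fun h' => hlt.not_ge (archNorm_mono hb h')
  rw [hv, hv.map_pow, hv.map_pow] at h3
  refine h3.trans (mul_le_mul_of_nonneg_right ?_ (pow_nonneg (v.nonneg _) n))
  simpa using v.natCast_le 2

/-- A tempered multiplicative seminorm with `|2| > 1`, all of whose values are bounded by those of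
rational numbers, is up to infinitesimals the complex norm along a ring homomorphism to `ℂ`. -/
theorem IsMultiplicative.exists_ringHom_complex (hv : v.IsMultiplicative) (hR : TemperedGrowth R)
    (h2 : 1 < v 2) (hb : ∀ x, ∃ r : ℚ, v x ≤ v (algebraMap ℚ A r)) {j : A} (hj : j * j = -1) :
    ∃ φ : A →+* ℂ, (∀ x y, v x ≤ v y → ‖φ x‖ ≤ ‖φ y‖) ∧
      ∀ x y, φ y ≠ 0 → ‖φ x‖ ≤ ‖φ y‖ → v x ≤ v y := by
  obtain ⟨φ, hφ⟩ := _root_.exists_ringHom_complex v.archNorm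
    (by simpa using hv.archNorm_ratCast hR h2 0) (by simpa using hv.archNorm_ratCast hR h2 1)
    (hv.archNorm_mul hR h2 hb) (hv.archNorm_add_le hR h2 hb) (algebraMap ℚ A)
    (hv.archNorm_ratCast hR h2) j hj
  refine ⟨φ, fun x y h => ?_, fun x y hy h => ?_⟩
  · rw [hφ, hφ]
    exact archNorm_mono hb h
  · rw [hφ, hφ] at h
    exact hv.le_of_archNorm_le hR h2 hb (by rwa [← hφ, norm_ne_zero_iff]) h

end ArchNorm

/-! ### Algebraic numbers are dominated by rationals. -/

section Algebraic

variable {K R : Type*} [Field K] [Algebra ℚ K] [Semifield R] [LinearOrder R] [IsPositiveHalo R]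
  {v : GenSeminorm K R}

/-- Sums of `d` terms produce the element `d` of `R`, which must be traded for a value of `v`. If no
integer sufficed, the powers of `v 2` would be bounded by `d`. -/
theorem IsMultiplicative.exists_natCast_le {A : Type*} [CommRing A] {v : GenSeminorm A R}
    (hv : v.IsMultiplicative) (hR : TemperedGrowth R) (h2 : 1 < v 2) (d : ℕ) :
    ∃ m : ℕ, (d : R) ≤ v (m : A) := by
  rcases eq_or_ne d 0 with rfl | hd
  · exact ⟨0, by simp [v.map_zero']⟩
  by_contra! h
  refine h2.not_ge (hR.le_of_pow_le_const hd fun n => ?_)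
  rw [← hv.map_pow, one_pow, mul_one]
  simpa using (h (2 ^ n)).le

/-- Cauchy's bound for roots: when `1 ≤ v c`, the minimal polynomial bounds `v c ^ (e + 1)` by a
rational value times `v c ^ e`. -/
theorem IsMultiplicative.exists_le_ratCast_of_isAlgebraic (hv : v.IsMultiplicative)
    (hR : TemperedGrowth R) (h2 : 1 < v 2) {c : K} (hc : IsAlgebraic ℚ c) :
    ∃ r : ℚ, v c ≤ v (algebraMap ℚ K r) := by
  rcases le_total (v c) 1 with h1 | h1
  · exact ⟨1, by rwa [map_one, v.map_one']⟩
  have hi := hc.isIntegral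
  set p := minpoly ℚ c
  obtain ⟨e, hd⟩ : ∃ e, p.natDegree = e + 1 :=
    Nat.exists_eq_succ_of_ne_zero (minpoly.natDegree_pos hi).ne'
  have hsum : c ^ (e + 1) = -∑ i ∈ Finset.range (e + 1), algebraMap ℚ K (p.coeff i) * c ^ i := by
    have h := minpoly.aeval ℚ c
    rw [(minpoly.monic hi).as_sum] at h
    simp only [map_add, map_sum, map_mul, _root_.map_pow, aeval_X, aeval_C] at h
    rw [← hd]
    exact eq_neg_of_add_eq_zero_left h
  set M : ℚ := ∑ i ∈ Finset.range (e + 1), |p.coeff i|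
  obtain ⟨m, hm⟩ := hv.exists_natCast_le hR h2 (e + 1)
  have hle : v c * v c ^ e ≤ v (algebraMap ℚ K (m * M)) * v c ^ e := by
    rw [← pow_succ', ← hv.map_pow, hsum, hv.map_neg]
    refine (v.sum_le _ _).trans ((Finset.sum_le_card_nsmul _ _
      (v (algebraMap ℚ K M) * v c ^ e) fun i hi => ?_).trans ?_)
    · rw [hv, hv.map_pow]
      refine mul_le_mul ?_ (pow_le_pow_right₀ h1 (Nat.le_of_lt_succ (Finset.mem_range.1 hi)))
        (pow_nonneg (v.nonneg _) _) (v.nonneg _)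
      rw [hv.ratCast_le_iff hR h2]
      exact (Finset.single_le_sum (f := fun i => |p.coeff i|) (fun i _ => abs_nonneg _) hi).trans
        (le_abs_self _)
    · rw [Finset.card_range, nsmul_eq_mul, map_mul, hv, map_natCast, mul_assoc]
      exact mul_le_mul_of_nonneg_right hm (mul_nonneg (v.nonneg _) (pow_nonneg (v.nonneg _) _))
  exact ⟨_, le_of_mul_le_mul_right hle (pow_pos (zero_lt_one.trans_le h1) e)⟩

theorem IsMultiplicative.exists_embedding [IsAlgClosed K] [Algebra.IsAlgebraic ℚ K]
    (hv : v.IsMultiplicative) (hR : TemperedGrowth R) (h2 : 1 < v 2) :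
    ∃ σ : K →+* ℂ, ∀ x y, v x ≤ v y ↔ ‖σ x‖ ≤ ‖σ y‖ := by
  obtain ⟨j, hj⟩ := IsAlgClosed.exists_pow_nat_eq (-1 : K) (n := 2) two_pos
  obtain ⟨σ, h1, h3⟩ := hv.exists_ringHom_complex hR h2
    (fun x => hv.exists_le_ratCast_of_isAlgebraic hR h2 (Algebra.IsAlgebraic.isAlgebraic x))
    (j := j) (by rw [← sq, hj])
  -- On a field `σ` is injective, so no infinitesimals obstruct the converse.
  refine ⟨σ, fun x y => ⟨h1 x y, fun h => ?_⟩⟩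
  rcases eq_or_ne y 0 with rfl | hy
  · have hx : x = 0 := by simpa using h
    rw [hx]
  · exact h3 x y ((_root_.map_ne_zero σ).2 hy) h

end Algebraic

end GenSeminorm

/-! ### The order on the two infinitesimal models. -/

namespace GenSeminorm

section Models

variable {F : Type*} [Field F] (σ : F →+* ℂ)

theorem taylor_natTrailingDegree_eq (a : F) (P : F[X]) :
    (taylor a P).natTrailingDegree = P.rootMultiplicity a := by
  rw [rootMultiplicity_eq_natTrailingDegree, taylor_apply]

theorem infSeminorm_apply (a : F) (P : F[X]) :
    infSeminorm σ a P = LexProd.inr ‖σ ((P /ₘ (X - C a) ^ P.rootMultiplicity a).eval a)‖₊ *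
      qSmall ^ P.rootMultiplicity a := by
  rw [eval_divByMonic_eq_trailingCoeff_comp, ← taylor_apply, ← taylor_natTrailingDegree_eq]
  rfl

/-- Translation by `a` changes neither degree nor leading coefficient, hence the independence of
`a`. -/
theorem inftySeminorm_apply (a : F) (P : F[X]) :
    inftySeminorm σ a P = LexProd.inr ‖σ P.leadingCoeff‖₊ * qLarge ^ P.natDegree := by
  rw [← leadingCoeff_taylor a P, ← natDegree_taylor P a]
  rfl

theorem infSeminorm_isMultiplicative (a : F) : (infSeminorm σ a).IsMultiplicative := by
  intro P Q
  by_cases hP : P = 0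
  · simp [hP, (infSeminorm σ a).map_zero']
  by_cases hQ : Q = 0
  · simp [hQ, (infSeminorm σ a).map_zero']
  have hP' := mt (taylor_eq_zero a P).1 hP
  have hQ' := mt (taylor_eq_zero a Q).1 hQ
  have h := trailingCoeff_mul (taylor a P) (taylor a Q)
  simp only [trailingCoeff] at h
  simp only [infSeminorm, infTerm]
  rw [taylor_mul, h, natTrailingDegree_mul hP' hQ', map_mul, nnnorm_mul, map_mul, pow_add,
    mul_mul_mul_comm]

theorem inftySeminorm_isMultiplicative (a : F) : (inftySeminorm σ a).IsMultiplicative := by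
  intro P Q
  by_cases hP : P = 0
  · simp [hP, (inftySeminorm σ a).map_zero']
  by_cases hQ : Q = 0
  · simp [hQ, (inftySeminorm σ a).map_zero']
  rw [inftySeminorm_apply, inftySeminorm_apply, inftySeminorm_apply, leadingCoeff_mul,
    natDegree_mul hP hQ, map_mul, nnnorm_mul, map_mul, pow_add, mul_mul_mul_comm]

theorem inr_mul_pow_lt_of_fst_lt {c d : ℝ≥0} (hc : c ≠ 0) (hd : d ≠ 0) {q : InfHalo} {i j : ℕ}
    (h : q.fst ^ j < q.fst ^ i) : LexProd.inr d * q ^ j < LexProd.inr c * q ^ i := by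
  refine lt_of_not_ge fun h' => ?_
  rw [LexProd.le_iff] at h'
  simp only [LexProd.mul_fst, LexProd.pow_fst, LexProd.inr_fst hc, LexProd.inr_fst hd, one_mul]
    at h'
  rcases h' with h' | ⟨h', -⟩
  · exact lt_asymm h h'
  · exact h.ne' h'

theorem inr_mul_le_inr_mul {c d : ℝ≥0} {z : InfHalo} (hz : z ≠ 0) :
    (LexProd.inr c : InfHalo) * z ≤ LexProd.inr d * z ↔ c ≤ d := by
  rw [mul_le_mul_iff_of_pos_right (IsPositiveHalo.pos_of_ne_zero hz)]
  refine ⟨fun h => ?_, LexProd.inr_mono⟩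
  by_contra! h'
  have h1 := le_antisymm h (LexProd.inr_mono h'.le)
  have h2 := congrArg LexProd.snd h1
  rw [LexProd.inr_snd, LexProd.inr_snd] at h2
  exact h'.ne' h2

theorem qSmall_ne_zero : qSmall ≠ 0 := fun h => by
  have := congrArg LexProd.snd h
  exact one_ne_zero this

theorem qLarge_ne_zero : qLarge ≠ 0 := fun h => by
  have := congrArg LexProd.snd h
  exact one_ne_zero this

end Models

/-! ### Multiplicative equivalence as equality of orders. -/

section Equivalence

variable {A R S : Type*} [CommRing A] [Semifield R] [LinearOrder R] [IsPositiveHalo R]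
  [Semifield S] [LinearOrder S] [IsPositiveHalo S] {v : GenSeminorm A R} {w : GenSeminorm A S}

/-- Multiplicativity absorbs the factor `c`, since `v a * v c = v (a * c)`. -/
theorem IsMultiplicative.mulEquivalent (hv : v.IsMultiplicative) (hw : w.IsMultiplicative)
    (h : ∀ x y, v x ≤ v y ↔ w x ≤ w y) : v.MulEquivalent w := by
  constructor <;> intro a b c <;> rw [← hv, ← hw, h] <;> exact id

theorem IsMultiplicative.mulEquivalent_of_ne_zero (hv : v.IsMultiplicative)
    (hw : w.IsMultiplicative) (hv0 : ∀ x, x ≠ 0 → v x ≠ 0) (hw0 : ∀ x, x ≠ 0 → w x ≠ 0)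
    (h : ∀ x y, x ≠ 0 → y ≠ 0 → (v x ≤ v y ↔ w x ≤ w y)) : v.MulEquivalent w := by
  refine hv.mulEquivalent hw fun x y => ?_
  rcases eq_or_ne x 0 with rfl | hx
  · simp [v.map_zero', w.map_zero', v.nonneg, w.nonneg]
  rcases eq_or_ne y 0 with rfl | hy
  · rw [v.map_zero', w.map_zero']
    exact iff_of_false (IsPositiveHalo.pos_of_ne_zero (hv0 x hx)).not_ge
      (IsPositiveHalo.pos_of_ne_zero (hw0 x hx)).not_ge
  · exact h x y hx hy

theorem IsMultiplicative.comap (hv : v.IsMultiplicative) {B : Type*} [CommRing B] (f : B →+* A) :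
    (v.comap f).IsMultiplicative := fun a b =>
  (congrArg v (map_mul f a b)).trans (hv _ _)

theorem complexNorm_isMultiplicative : complexNorm.IsMultiplicative := nnnorm_mul

end Equivalence

/-! ### Seminorms on polynomials: non-trivial kernel, and the upper bounded cases. -/

section Polynomial

variable {K R : Type*} [Field K] [Semifield R] [LinearOrder R] [IsPositiveHalo R]
  {v : GenSeminorm K[X] R}

/-- A multiplicative generalized seminorm as a monoid homomorphism. -/
def IsMultiplicative.toMonoidWithZeroHom {A : Type*} [CommRing A] {v : GenSeminorm A R}
    (hv : v.IsMultiplicative) : A →*₀ R where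
  toFun := v
  map_zero' := v.map_zero'
  map_one' := v.map_one'
  map_mul' := hv

/-- The polynomial splits and its leading coefficient is a unit, so a linear factor must vanish. The
generality serves both seminorms and ring homomorphisms to `ℂ`. -/
theorem exists_root_of_monoidWithZeroHom_eq_zero [IsAlgClosed K] {M : Type*}
    [CommMonoidWithZero M] [NoZeroDivisors M] [Nontrivial M] (f : K[X] →*₀ M) {P : K[X]}
    (hP : P ≠ 0) (h : f P = 0) : ∃ a, f (X - C a) = 0 := by
  rw [(IsAlgClosed.splits P).eq_prod_roots, map_mul, mul_eq_zero] at h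
  rcases h with h | h
  · exfalso
    have h1 : f (C P.leadingCoeff) * f (C P.leadingCoeff⁻¹) = 1 := by
      rw [← map_mul, ← C_mul, mul_inv_cancel₀ (leadingCoeff_ne_zero.2 hP), C_1, map_one]
    rw [h, zero_mul] at h1
    exact zero_ne_one h1
  · rw [map_multiset_prod, Multiset.prod_eq_zero_iff, Multiset.map_map] at h
    obtain ⟨a, -, ha⟩ := Multiset.mem_map.1 h
    exact ⟨a, ha⟩

theorem IsMultiplicative.eq_eval_of_map_X_sub_C_eq_zero (hv : v.IsMultiplicative) {a : K}
    (ha : v (X - C a) = 0) (P : K[X]) : v P = v (C (P.eval a)) := by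
  obtain ⟨Q, hQ⟩ := X_sub_C_dvd_sub_C_eval (a := a) (p := P)
  have h0 : v (P - C (P.eval a)) = 0 := by rw [hQ, hv, ha, zero_mul]
  apply le_antisymm
  · have := v.map_add_le' (P - C (P.eval a)) (C (P.eval a))
    rwa [sub_add_cancel, h0, zero_add] at this
  · have := v.map_add_le' (-(P - C (P.eval a))) P
    rwa [neg_sub, sub_add_cancel, ← neg_sub, hv.map_neg, h0, zero_add] at this

theorem IsMultiplicative.map_eq_rootMultiplicity (hv : v.IsMultiplicative) (a : K) (P : K[X]) :
    v P = v (X - C a) ^ P.rootMultiplicity a *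
      v (P /ₘ (X - C a) ^ P.rootMultiplicity a) := by
  rw [← hv.map_pow, ← hv, pow_mul_divByMonic_rootMultiplicity_eq]

theorem IsMultiplicative.map_eq_prod_roots [IsAlgClosed K] (hv : v.IsMultiplicative) {w : R}
    (hw : ∀ a, v (X - C a) = w) (P : K[X]) :
    v P = v (C P.leadingCoeff) * w ^ P.natDegree := by
  have hs := IsAlgClosed.splits P
  have h : v P = hv.toMonoidWithZeroHom P := rfl
  rw [h, hs.eq_prod_roots, map_mul, map_multiset_prod, Multiset.map_map]
  have h1 : (P.roots.map (hv.toMonoidWithZeroHom ∘ fun a => X - C a)) =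
      Multiset.replicate P.roots.card w :=
    Multiset.eq_replicate.2 ⟨by simp, fun b hb => by
      obtain ⟨a, -, rfl⟩ := Multiset.mem_map.1 hb
      exact hw a⟩
  rw [h1, Multiset.prod_replicate, ← hs.natDegree_eq_card_roots, ← hs.eq_prod_roots]
  rfl

/-- The two `ℚ`-algebra structures are independent instances; they are compatible because ring
homomorphisms out of `ℚ` are unique. -/
theorem map_C_algebraMap [Algebra ℚ K] [Algebra ℚ K[X]] (v : GenSeminorm K[X] R) (r : ℚ) :
    v (C (algebraMap ℚ K r)) = v (algebraMap ℚ K[X] r) :=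
  congrArg v (congrFun (congrArg DFunLike.coe
    (Subsingleton.elim (C.comp (algebraMap ℚ K)) (algebraMap ℚ K[X]))) r)

theorem IsMultiplicative.exists_polynomial_ringHom [IsAlgClosed K] [Algebra ℚ K[X]]
    (hv : v.IsMultiplicative)
    (hR : TemperedGrowth R) (h2 : 1 < v 2) (hu : v.UpperBounded) :
    ∃ φ : K[X] →+* ℂ, (∀ x y, v x ≤ v y → ‖φ x‖ ≤ ‖φ y‖) ∧
      ∀ x y, φ y ≠ 0 → ‖φ x‖ ≤ ‖φ y‖ → v x ≤ v y := by
  obtain ⟨j, hj⟩ := IsAlgClosed.exists_pow_nat_eq (-1 : K) (n := 2) two_pos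
  refine hv.exists_ringHom_complex hR h2 (fun x => ?_) (j := C j)
    (by rw [← C_mul, ← sq, hj, C_neg, C_1])
  rcases eq_or_ne x 0 with rfl | hx
  · exact ⟨0, by simp⟩
  · obtain ⟨r, -, hr⟩ := hu x hx
    exact ⟨r, hr⟩

/-- In the expansion of `(T + C b) ^ n`, the constant multiplying `T ^ k` has value at most `v T ^
(n - k)`, binomial coefficient included. Thus `v (T + C b) ^ n` is at most `(n + 1) * v T ^ n`. -/
theorem IsMultiplicative.map_add_C_le (hv : v.IsMultiplicative) (hR : TemperedGrowth R)
    {T : K[X]} (hT : ∀ c : K, v (C c) < v T) (b : K) : v (T + C b) ≤ v T := by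
  have h1 : 1 ≤ v T := by simpa [v.map_one'] using (hT 1).le
  refine hR.le_of_pow_le_linear one_ne_zero fun n => ?_
  rw [← hv.map_pow, add_pow]
  refine (v.sum_le _ _).trans ?_
  have : ∀ k ∈ Finset.range (n + 1), v (T ^ k * C b ^ (n - k) * (n.choose k : K[X])) ≤ v T ^ n := by
    intro k hk
    have hk' : k ≤ n := Nat.le_of_lt_succ (Finset.mem_range.1 hk)
    have hC : C b ^ (n - k) * (n.choose k : K[X]) = C (b ^ (n - k) * (n.choose k : K)) := by
      simp
    rw [mul_assoc, hC, hv, hv.map_pow]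
    conv_rhs => rw [← Nat.add_sub_of_le hk', pow_add]
    refine mul_le_mul_of_nonneg_left ?_ (pow_nonneg (v.nonneg _) _)
    rcases hk'.eq_or_lt with rfl | hlt
    · simp [v.map_one']
    · exact (hT _).le.trans (le_self_pow₀ h1 (Nat.sub_ne_zero_of_lt hlt))
  refine (Finset.sum_le_card_nsmul _ _ _ this).trans_eq ?_
  simp

theorem IsMultiplicative.exists_map_C_le [Algebra ℚ K] [Algebra.IsAlgebraic ℚ K] [Algebra ℚ K[X]]
    (hv : v.IsMultiplicative) (hR : TemperedGrowth R)
    (h2 : 1 < v 2) (c : K) : ∃ r : ℚ, v (C c) ≤ v (algebraMap ℚ K[X] r) := by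
  obtain ⟨r, hr⟩ := (hv.comap C).exists_le_ratCast_of_isAlgebraic hR
    (by change 1 < v (C 2); rwa [map_ofNat C 2])
    (Algebra.IsAlgebraic.isAlgebraic (R := ℚ) c)
  exact ⟨r, hr.trans_eq (v.map_C_algebraMap r)⟩

theorem IsMultiplicative.exists_le_map_C [Algebra ℚ K] [Algebra.IsAlgebraic ℚ K] [Algebra ℚ K[X]]
    (hv : v.IsMultiplicative) (hR : TemperedGrowth R)
    (h2 : 1 < v 2) {c : K} (hc : c ≠ 0) :
    ∃ r : ℚ, r ≠ 0 ∧ v (algebraMap ℚ K[X] r) ≤ v (C c) := by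
  have hcc : C c⁻¹ * C c = (1 : K[X]) := by rw [← C_mul, inv_mul_cancel₀ hc, C_1]
  obtain ⟨r, hr⟩ := hv.exists_map_C_le hR h2 c⁻¹
  have hpos := IsPositiveHalo.pos_of_ne_zero (hv.map_ne_zero_of_unit hcc)
  have hr0 : r ≠ 0 := by
    rintro rfl
    rw [map_zero, v.map_zero'] at hr
    exact hpos.not_ge hr
  refine ⟨r⁻¹, inv_ne_zero hr0, ?_⟩
  have h1 : v (algebraMap ℚ K[X] r) * v (algebraMap ℚ K[X] r⁻¹) = 1 := by
    rw [← hv, ← map_mul, mul_inv_cancel₀ hr0, map_one, v.map_one']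
  have h3 : v (C c⁻¹) * v (C c) = 1 := by rw [← hv, hcc, v.map_one']
  refine le_of_mul_le_mul_left ?_ hpos
  rw [h3, ← h1]
  exact mul_le_mul_of_nonneg_right hr (v.nonneg _)

theorem IsMultiplicative.exists_embedding_C [Algebra ℚ K] [Algebra.IsAlgebraic ℚ K] [IsAlgClosed K]
    (hv : v.IsMultiplicative) (hR : TemperedGrowth R)
    (h2 : 1 < v 2) : ∃ σ : K →+* ℂ, ∀ x y, v (C x) ≤ v (C y) ↔ ‖σ x‖ ≤ ‖σ y‖ :=
  (hv.comap C).exists_embedding hR (by change 1 < v (C 2); rwa [map_ofNat C 2])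

theorem IsMultiplicative.exists_mulEquivalent_of_hasNontrivialKernel [Algebra ℚ K]
    [Algebra.IsAlgebraic ℚ K] [IsAlgClosed K] (hv : v.IsMultiplicative) (hR : TemperedGrowth R)
    (h2 : 1 < v 2) (hk : v.HasNontrivialKernel) :
    ∃ (σ : K →+* ℂ) (a : K), v.MulEquivalent (complexNorm.comap (σ.comp (evalRingHom a))) := by
  obtain ⟨P, hP, h0⟩ := hk
  obtain ⟨a, ha⟩ := exists_root_of_monoidWithZeroHom_eq_zero hv.toMonoidWithZeroHom hP h0
  obtain ⟨σ, hσ⟩ := hv.exists_embedding_C hR h2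
  refine ⟨σ, a, hv.mulEquivalent (complexNorm_isMultiplicative.comap _) fun x y => ?_⟩
  rw [hv.eq_eval_of_map_X_sub_C_eq_zero ha x, hv.eq_eval_of_map_X_sub_C_eq_zero ha y, hσ]
  exact Iff.rfl

theorem IsMultiplicative.exists_mulEquivalent_of_bounded [IsAlgClosed K] [Algebra ℚ K[X]]
    (hv : v.IsMultiplicative)
    (hR : TemperedGrowth R) (h2 : 1 < v 2) (hk : ¬ v.HasNontrivialKernel) (hu : v.UpperBounded)
    (hl : v.LowerBounded) :
    ∃ (σ : K →+* ℂ) (z : ℂ), z ∉ Set.range σ ∧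
      v.MulEquivalent ((complexNorm.comap (evalRingHom z)).comap (mapRingHom σ)) := by
  obtain ⟨φ, h1, h3⟩ := hv.exists_polynomial_ringHom hR h2 hu
  -- A non-zero rational below `P` keeps `φ P` away from zero.
  have hφ0 : ∀ P, P ≠ 0 → φ P ≠ 0 := fun P hP h => by
    obtain ⟨r, hr, hrP⟩ := hl P hP
    have := h1 _ _ hrP
    rw [h, norm_zero, norm_le_zero_iff] at this
    simp [hr] at this
  have hφ : φ = (evalRingHom (φ X)).comp (mapRingHom (φ.comp C)) := by
    ext <;> simp
  refine ⟨φ.comp C, φ X, ?_, ?_⟩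
  · rintro ⟨a, ha⟩
    refine hφ0 (X - C a) (X_sub_C_ne_zero a) ?_
    rw [map_sub, ← ha]
    exact sub_self _
  · refine hv.mulEquivalent_of_ne_zero ((complexNorm_isMultiplicative.comap _).comap _)
      (fun x => v.map_ne_zero hk) (fun x hx => ?_) fun x y _ hy => ?_
    · change ‖((evalRingHom (φ X)).comp (mapRingHom (φ.comp C))) x‖₊ ≠ 0
      rw [← hφ]
      exact nnnorm_ne_zero_iff.2 (hφ0 x hx)
    · change _ ↔ ‖((evalRingHom (φ X)).comp (mapRingHom (φ.comp C))) x‖₊ ≤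
        ‖((evalRingHom (φ X)).comp (mapRingHom (φ.comp C))) y‖₊
      rw [← hφ]
      exact ⟨h1 x y, h3 x y (hφ0 y hy)⟩

theorem IsMultiplicative.exists_mulEquivalent_infSeminorm [IsAlgClosed K] [Algebra ℚ K[X]]
    (hv : v.IsMultiplicative)
    (hR : TemperedGrowth R) (h2 : 1 < v 2) (hk : ¬ v.HasNontrivialKernel) (hu : v.UpperBounded)
    (hl : ¬ v.LowerBounded) :
    ∃ (σ : K →+* ℂ) (a : K), v.MulEquivalent (infSeminorm σ a) := by
  obtain ⟨φ, h1, h3⟩ := hv.exists_polynomial_ringHom hR h2 hu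
  have hC : ∀ c : K, c ≠ 0 → φ (C c) ≠ 0 := fun c hc =>
    (_root_.map_ne_zero (φ.comp C)).2 hc
  -- A polynomial below every non-zero rational is killed by `φ`: otherwise a positive rational less
  -- than `‖φ P‖` would lie below it.
  obtain ⟨a, ha⟩ : ∃ a, φ (X - C a) = 0 := by
    simp only [LowerBounded, not_forall, not_exists, not_and] at hl
    obtain ⟨P, hP, hlt⟩ := hl
    refine exists_root_of_monoidWithZeroHom_eq_zero φ.toMonoidWithZeroHom hP ?_
    by_contra h
    have h : φ P ≠ 0 := h
    obtain ⟨r, hr0, hr⟩ := exists_rat_btwn (norm_pos_iff.2 h)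
    have hr0' : r ≠ 0 := by rintro rfl; simp at hr0
    refine hlt r hr0' (h3 _ _ h ?_)
    have hφr : φ (algebraMap ℚ K[X] r) = r := eq_ratCast (φ.comp (algebraMap ℚ K[X])) r
    rw [hφr, Complex.norm_ratCast, abs_of_pos hr0]
    exact hr.le
  have heval : ∀ Q : K[X], φ Q = φ (C (Q.eval a)) := fun Q => by
    obtain ⟨T, hT⟩ := X_sub_C_dvd_sub_C_eval (a := a) (p := Q)
    rw [← sub_eq_zero, ← map_sub, hT, map_mul, ha, zero_mul]
  set ε := v (X - C a) with hε
  have hε0 : ε ≠ 0 := v.map_ne_zero hk (X_sub_C_ne_zero a)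
  have hsmall : ∀ Q : K[X], Q.eval a ≠ 0 → ε < v Q := fun Q hQ => by
    by_contra! h
    have := h1 _ _ h
    rw [ha, norm_zero, norm_le_zero_iff, heval] at this
    exact hC _ hQ this
  have hε1 : ε ≤ 1 := by simpa [v.map_one'] using (hsmall 1 (by simp)).le
  -- The cofactor of the power of `X - C a` does not vanish at `a`, so it and its value at `a` have
  -- the same non-zero image under `φ`, hence the same seminorm.
  have hval : ∀ P ≠ 0, v P = ε ^ P.rootMultiplicity a *
      v (C ((P /ₘ (X - C a) ^ P.rootMultiplicity a).eval a)) := fun P hP => by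
    have hne := hC _ (eval_divByMonic_pow_rootMultiplicity_ne_zero a hP)
    rw [hv.map_eq_rootMultiplicity a P]
    congr 1
    exact le_antisymm (h3 _ _ hne (by rw [← heval]))
      (h3 _ _ (by rwa [heval]) (by rw [← heval]))
  -- As `ε < v (C (c / d))`, the exponent of `ε` decides before the constants do: this is the
  -- lexicographic order of `InfHalo`.
  have hlt : ∀ {c d : K} {i j : ℕ}, c ≠ 0 → d ≠ 0 → i < j →
      ε ^ j * v (C d) < ε ^ i * v (C c) := fun {c d i j} hc hd hij => by
    obtain ⟨k, rfl⟩ := Nat.exists_eq_add_of_lt hij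
    have hcd : v (C c) = v (C (c / d)) * v (C d) := by
      rw [← hv, ← C_mul, div_mul_cancel₀ c hd]
    have hεcd : ε < v (C (c / d)) := hsmall _ (by simp [hc, hd])
    have hd' : 0 < v (C d) := IsPositiveHalo.pos_of_ne_zero (v.map_ne_zero hk (C_ne_zero.2 hd))
    rw [hcd, add_assoc, pow_add, mul_assoc]
    refine mul_lt_mul_of_pos_left (mul_lt_mul_of_pos_right ?_ hd')
      (pow_pos (IsPositiveHalo.pos_of_ne_zero hε0) i)
    exact (pow_le_of_le_one (v.nonneg _) hε1 k.succ_ne_zero).trans_lt hεcd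
  refine ⟨φ.comp C, a, hv.mulEquivalent_of_ne_zero (infSeminorm_isMultiplicative _ a)
    (fun x => v.map_ne_zero hk) (fun x hx => ?_) fun x y hx hy => ?_⟩
  · rw [infSeminorm_apply]
    exact mul_ne_zero ((_root_.map_ne_zero _).2 (nnnorm_ne_zero_iff.2
      (hC _ (eval_divByMonic_pow_rootMultiplicity_ne_zero a hx)))) (pow_ne_zero _ qSmall_ne_zero)
  · rw [infSeminorm_apply, infSeminorm_apply, hval x hx, hval y hy]
    have hcx := eval_divByMonic_pow_rootMultiplicity_ne_zero a hx
    have hcy := eval_divByMonic_pow_rootMultiplicity_ne_zero a hy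
    rcases lt_trichotomy (x.rootMultiplicity a) (y.rootMultiplicity a) with h | h | h
    · exact iff_of_false (hlt hcx hcy h).not_ge (inr_mul_pow_lt_of_fst_lt
        (nnnorm_ne_zero_iff.2 (hC _ hcx)) (nnnorm_ne_zero_iff.2 (hC _ hcy))
        (qSmall_pow_lt h)).not_ge
    · rw [h] at hcx ⊢
      rw [mul_le_mul_iff_of_pos_left (pow_pos (IsPositiveHalo.pos_of_ne_zero hε0) _),
        inr_mul_le_inr_mul (pow_ne_zero _ qSmall_ne_zero)]
      exact ⟨h1 _ _, h3 _ _ (hC _ hcy)⟩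
    · exact iff_of_true (hlt hcy hcx h).le (inr_mul_pow_lt_of_fst_lt
        (nnnorm_ne_zero_iff.2 (hC _ hcy)) (nnnorm_ne_zero_iff.2 (hC _ hcx)) (qSmall_pow_lt h)).le

end Polynomial

/-! ### Seminorms that are not upper bounded: the point at infinity. -/

section NotUpperBounded

variable {K R : Type*} [Field K] [Algebra ℚ K] [Algebra.IsAlgebraic ℚ K]
  [Algebra ℚ K[X]] [Semifield R] [LinearOrder R] [IsPositiveHalo R] {v : GenSeminorm K[X] R}

/-- Elements dominated by rationals are stable under sums and products and contain the constants, so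
it is enough that they contain `X`. -/
theorem IsMultiplicative.upperBounded_of_map_X_sub_C_le (hv : v.IsMultiplicative)
    (hR : TemperedGrowth R) (h2 : 1 < v 2) {a c : K} (h : v (X - C a) ≤ v (C c)) :
    v.UpperBounded := by
  have hadd : ∀ P Q : K[X], (∃ r : ℚ, v P ≤ v (algebraMap ℚ K[X] r)) →
      (∃ r : ℚ, v Q ≤ v (algebraMap ℚ K[X] r)) → ∃ r : ℚ, v (P + Q) ≤ v (algebraMap ℚ K[X] r) := by
    rintro P Q ⟨r, hr⟩ ⟨s, hs⟩
    rw [← hv.map_abs_ratCast] at hr hs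
    exact ⟨_, hv.map_add_le_ratCast hR h2 (abs_nonneg r) (abs_nonneg s) hr hs⟩
  have hmul : ∀ P Q : K[X], (∃ r : ℚ, v P ≤ v (algebraMap ℚ K[X] r)) →
      (∃ r : ℚ, v Q ≤ v (algebraMap ℚ K[X] r)) → ∃ r : ℚ, v (P * Q) ≤ v (algebraMap ℚ K[X] r) := by
    rintro P Q ⟨r, hr⟩ ⟨s, hs⟩
    refine ⟨r * s, ?_⟩
    rw [map_mul, hv, hv]
    exact mul_le_mul hr hs (v.nonneg _) (v.nonneg _)
  have hX : ∃ r : ℚ, v X ≤ v (algebraMap ℚ K[X] r) := by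
    rw [← sub_add_cancel (X : K[X]) (C a)]
    obtain ⟨r, hr⟩ := hv.exists_map_C_le hR h2 c
    exact hadd _ _ ⟨r, h.trans hr⟩ (hv.exists_map_C_le hR h2 a)
  have hall : ∀ P : K[X], ∃ r : ℚ, v P ≤ v (algebraMap ℚ K[X] r) := fun P => by
    induction P using Polynomial.induction_on with
    | C b => exact hv.exists_map_C_le hR h2 b
    | add P Q hP hQ => exact hadd P Q hP hQ
    | monomial n b ih =>
      rw [pow_succ, ← mul_assoc]
      exact hmul _ _ ih hX
  intro P _
  obtain ⟨r, hr⟩ := hall P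
  rcases eq_or_ne r 0 with rfl | hr0
  · exact ⟨1, one_ne_zero, hr.trans (by rw [map_zero, v.map_zero']; exact v.nonneg _)⟩
  · exact ⟨r, hr0, hr⟩

theorem IsMultiplicative.map_C_lt_map_X_sub_C (hv : v.IsMultiplicative) (hR : TemperedGrowth R)
    (h2 : 1 < v 2) (hu : ¬ v.UpperBounded) (a c : K) : v (C c) < v (X - C a) :=
  lt_of_not_ge fun h => hu (hv.upperBounded_of_map_X_sub_C_le hR h2 h)

/-- Each `X - C a` dominates all constants, so by `map_add_C_le` no translation can increase its
value; symmetry gives equality. -/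
theorem IsMultiplicative.map_X_sub_C_eq (hv : v.IsMultiplicative) (hR : TemperedGrowth R)
    (h2 : 1 < v 2) (hu : ¬ v.UpperBounded) (a : K) : v (X - C a) = v X := by
  have key : ∀ a b : K, v (X - C b) ≤ v (X - C a) := fun a b => by
    have := hv.map_add_C_le hR (hv.map_C_lt_map_X_sub_C hR h2 hu a) (a - b)
    rwa [C_sub, sub_add_sub_cancel] at this
  simpa using le_antisymm (key 0 a) (key a 0)

theorem IsMultiplicative.map_C_lt_map_X (hv : v.IsMultiplicative) (hR : TemperedGrowth R)
    (h2 : 1 < v 2) (hu : ¬ v.UpperBounded) (c : K) : v (C c) < v X := by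
  simpa using hv.map_C_lt_map_X_sub_C hR h2 hu 0 c

theorem IsMultiplicative.lowerBounded_of_not_upperBounded [IsAlgClosed K]
    (hv : v.IsMultiplicative) (hR : TemperedGrowth R) (h2 : 1 < v 2) (hu : ¬ v.UpperBounded) : v.LowerBounded := by
  intro P hP
  obtain ⟨r, hr0, hr⟩ := hv.exists_le_map_C hR h2 (leadingCoeff_ne_zero.2 hP)
  refine ⟨r, hr0, hr.trans ?_⟩
  rw [hv.map_eq_prod_roots (hv.map_X_sub_C_eq hR h2 hu) P]
  refine le_mul_of_one_le_right (v.nonneg _) (one_le_pow₀ ?_)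
  simpa [v.map_one'] using (hv.map_C_lt_map_X hR h2 hu 1).le

theorem IsMultiplicative.exists_mulEquivalent_inftySeminorm [IsAlgClosed K]
    (hv : v.IsMultiplicative) (hR : TemperedGrowth R) (h2 : 1 < v 2) (hk : ¬ v.HasNontrivialKernel)
    (hu : ¬ v.UpperBounded) : ∃ σ : K →+* ℂ, ∀ a : K, v.MulEquivalent (inftySeminorm σ a) := by
  obtain ⟨σ, hσ⟩ := hv.exists_embedding_C hR h2
  have hC : ∀ c : K, c ≠ 0 → ‖σ c‖₊ ≠ 0 := fun c hc =>
    nnnorm_ne_zero_iff.2 ((_root_.map_ne_zero σ).2 hc)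
  have hval := hv.map_eq_prod_roots (hv.map_X_sub_C_eq hR h2 hu)
  set ω := v X
  have hω0 : 0 < ω := IsPositiveHalo.pos_of_ne_zero (v.map_ne_zero hk X_ne_zero)
  have hω1 : 1 ≤ ω := by simpa [v.map_one'] using (hv.map_C_lt_map_X hR h2 hu 1).le
  -- Here `v (C (c / d)) < ω`, so the larger degree wins whatever the coefficients.
  have hlt : ∀ {c d : K} {i j : ℕ}, d ≠ 0 → i < j →
      v (C c) * ω ^ i < v (C d) * ω ^ j := fun {c d i j} hd hij => by
    obtain ⟨k, rfl⟩ := Nat.exists_eq_add_of_lt hij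
    have hcd : v (C c) = v (C d) * v (C (c / d)) := by
      rw [← hv, ← C_mul, mul_div_cancel₀ c hd]
    have hd' : 0 < v (C d) := IsPositiveHalo.pos_of_ne_zero (v.map_ne_zero hk (C_ne_zero.2 hd))
    rw [hcd, add_assoc, add_comm i, pow_add, ← mul_assoc]
    refine mul_lt_mul_of_pos_right (mul_lt_mul_of_pos_left ?_ hd') (pow_pos hω0 i)
    exact (hv.map_C_lt_map_X hR h2 hu _).trans_le (le_self_pow₀ hω1 k.succ_ne_zero)
  refine ⟨σ, fun a => hv.mulEquivalent_of_ne_zero (inftySeminorm_isMultiplicative _ a)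
    (fun x => v.map_ne_zero hk) (fun x hx => ?_) fun x y hx hy => ?_⟩
  · rw [inftySeminorm_apply]
    exact mul_ne_zero ((_root_.map_ne_zero _).2 (hC _ (leadingCoeff_ne_zero.2 hx)))
      (pow_ne_zero _ qLarge_ne_zero)
  · rw [inftySeminorm_apply, inftySeminorm_apply, hval x, hval y]
    have hcx := leadingCoeff_ne_zero.2 hx
    have hcy := leadingCoeff_ne_zero.2 hy
    rcases lt_trichotomy x.natDegree y.natDegree with h | h | h
    · exact iff_of_true (hlt hcy h).le
        (inr_mul_pow_lt_of_fst_lt (hC _ hcy) (hC _ hcx) (qLarge_pow_lt h)).le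
    · rw [h, mul_le_mul_iff_of_pos_right (pow_pos hω0 _),
        inr_mul_le_inr_mul (pow_ne_zero _ qLarge_ne_zero)]
      exact hσ _ _
    · exact iff_of_false (hlt hcx h).not_ge
        (inr_mul_pow_lt_of_fst_lt (hC _ hcx) (hC _ hcy) (qLarge_pow_lt h)).not_ge

end NotUpperBounded
end GenSeminorm

/-! ### The classification over the algebraic closure of `ℚ`. -/

theorem mainTheorem3 {R : Type*} [Semifield R] [LinearOrder R] [IsPositiveHalo R]
    (hR : TemperedGrowth R) (v : GenSeminorm (AlgebraicClosure ℚ)[X] R)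
    (hv : v.IsMultiplicative) (h2 : 1 < v 2) :
    (v.HasNontrivialKernel →
      ∃ (σ : AlgebraicClosure ℚ →+* ℂ) (a : AlgebraicClosure ℚ),
        v.MulEquivalent (complexNorm.comap (σ.comp (evalRingHom a)))) ∧
    (¬ v.HasNontrivialKernel → v.UpperBounded → v.LowerBounded →
      ∃ (σ : AlgebraicClosure ℚ →+* ℂ) (z : ℂ), z ∉ Set.range σ ∧
        v.MulEquivalent ((complexNorm.comap (evalRingHom z)).comap (mapRingHom σ))) ∧
    (¬ v.HasNontrivialKernel → v.UpperBounded → ¬ v.LowerBounded →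
      ∃ (σ : AlgebraicClosure ℚ →+* ℂ) (a : AlgebraicClosure ℚ),
        v.MulEquivalent (infSeminorm σ a)) ∧
    (¬ v.HasNontrivialKernel → v.LowerBounded → ¬ v.UpperBounded →
      ∃ σ : AlgebraicClosure ℚ →+* ℂ, ∀ a : AlgebraicClosure ℚ,
        v.MulEquivalent (inftySeminorm σ a)) ∧
    (¬ v.HasNontrivialKernel → v.UpperBounded ∨ v.LowerBounded) := by
  -- The `ℚ`-algebra structure found here may differ in form from that of
  -- `AlgebraicClosure.isAlgebraic`; the two agree by uniqueness.
  have : Algebra.IsAlgebraic ℚ (AlgebraicClosure ℚ) := by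
    convert AlgebraicClosure.isAlgebraic ℚ
    · rfl
    · exact Subsingleton.elim _ _
  exact ⟨hv.exists_mulEquivalent_of_hasNontrivialKernel hR h2,
    hv.exists_mulEquivalent_of_bounded hR h2,
    hv.exists_mulEquivalent_infSeminorm hR h2,
    fun hk _ => hv.exists_mulEquivalent_inftySeminorm hR h2 hk,
    fun _ => or_iff_not_imp_left.2 (hv.lowerBounded_of_not_upperBounded hR h2)⟩
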